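/- Let $n\ge 1$, $\gamma\in(0,1)$, $T,\tau,s,p>0$. Write $\widehat f(\xi)=(2\pi)^{-n/2}\int_{\mathbb R^n}f(x)e^{-ix\cdot\xi}\,dx$ for the (unitary) Fourier transform on $L^2(\mathbb R^n)$, $\|f\|_{H^l}=\|(1+|\xi|^2)^{l/2}\widehat f\|_{L^2}$, and $E_{\gamma,1}(z)=\sum_{k\ge0}z^k/\Gamma(\gamma k+1)$. Let $u\in C([0,T],L^2(\mathbb R^n))\cap C((0,T],H^2(\mathbb R^n))$ be a weak solution of the final value problem $$\frac{\partial^\gamma u}{\partial t^\gamma}=\Delta u \ \text{ in } \mathbb R^n\times(0,T),\qquad u(\cdot,T)=g,$$ where $\frac{\partial^\gamma u}{\partial t^\gamma}(\cdot,t)=\frac1{\Gamma(1-\gamma)}\int_0^t\frac{u'(r)}{(t-r)^\gamma}\,dr$ is the Caputo derivative of the $L^2$-valued function $t\mapsto u(\cdot,t)$ and the equation holds in $L^2(\mathbb R^n)$ for every $t\in(0,T)$. Assume $u(\cdot,0)\in H^p(\mathbb R^n)$ with $\|u(\cdot,0)\|_{H^p}\le E$, $E>0$, and let $g^\delta\in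 L^2(\mathbb R^n)$ satisfy $\|g-g^\delta\|_{L^2}\le\delta$, $\delta>0$. For $\alpha>0$ let the regularized solution $u^\delta_\alpha$ be defined by $$\widehat{u^\delta_\alpha}(\xi,t)=\sqrt{2\pi}^{\,n}\,\frac{E_{\gamma,1}(-|\xi|^2t^\gamma)}{E_{\gamma,1}(-|\xi|^2T^\gamma)}\,\widehat\varphi(\alpha\xi)\,\widehat{g^\delta}(\xi),\qquad \widehat\varphi(\xi)=\frac{1}{\sqrt{2\pi}^{\,n}}e^{-\tau|\xi|^s},$$ and put $\alpha(\delta)=(\delta/E)^{1/(p+2)}$. Let $M>0$ be a fixed (arbitrarily large) bound for the ratio $\delta/E$. Then there are constants $C,\tilde C>0$ depending only on $n,\gamma,T,\tau,s,p,M$ (so independent of $\delta$, $E$, $t$, $l$, $u$, $g$, $g^\delta$) such that: 1. for all $t\in(0,T]$ and all $l\in[0,p+2]$ with $p+2-l\le s$, if $\delta\le ME$ or $l=0$, then $$\|u(\cdot,t)-u^\delta_{\alpha(\delta)}(\cdot,t)\|_{H^l}\le\frac{C}{t^\gamma}\,E^{\frac{l}{p+2}}\,\delta^{1-\frac{l}{p+2}};$$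 2. for all $t\in(0,T]$ and all $l\in[0,p]$ with $p-l\le s$, if $\delta\le ME$, then $$\|u(\cdot,t)-u^\delta_{\alpha(\delta)}(\cdot,t)\|_{H^l}\le\tilde C\,E^{\frac{2+l}{p+2}}\,\delta^{\frac{p-l}{p+2}}.$$ -/

import Mathlib

open MeasureTheory Filter Topology Set
open scoped ENNReal FourierTransform Laplacian SchwartzMap

noncomputable section

namespace FractionalDiffusion

/-- The space `L²(ℝⁿ)` (complex valued). -/
abbrev L2 (n : ℕ) : Type :=
  Lp (α := EuclideanSpace ℝ (Fin n)) ℂ 2 (volume : Measure (EuclideanSpace ℝ (Fin n)))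

/-- The Mittag-Leffler function `E_{γ,1}(z) = ∑ₖ zᵏ / Γ(γ k + 1)`, on the real line. -/
def mittagLeffler (γ z : ℝ) : ℝ :=
  ∑' k : ℕ, z ^ k / Real.Gamma (γ * k + 1)

/-- The left Caputo derivative of order `γ ∈ (0,1)`,
`(1 / Γ(1-γ)) ∫₀ᵗ (t - s)^(-γ) u'(s) ds`, as a Bochner integral. -/
def caputoDeriv {F : Type*} [NormedAddCommGroup F] [NormedSpace ℝ F] (γ : ℝ) (u : ℝ → F) (t : ℝ) :
    F :=
  (Real.Gamma (1 - γ))⁻¹ • ∫ s in (0 : ℝ)..t, (t - s) ^ (-γ) • deriv u s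

/-- The Sobolev norm `‖f‖_{H^l} = ‖(1 + |ξ|²)^(l/2) f̂(ξ)‖_{L²}`, where `f̂` is the unitary Fourier
transform in the angular frequency `ξ`. In terms of the Fourier transform `𝓕` of Mathlib, whose
frequency variable `η` is related to `ξ` by `ξ = 2πη` (so `f̂(ξ) = (2π)^(-n/2) 𝓕 f (ξ/2π)`), this is
the `L²`-norm of `η ↦ (1 + |2πη|²)^(l/2) 𝓕 f (η)`.
It takes the value `∞` exactly when `f ∉ H^l`. -/
def sobolevNorm {n : ℕ} (l : ℝ) (f : L2 n) : ℝ≥0∞ :=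
  eLpNorm (fun η : EuclideanSpace ℝ (Fin n) =>
    (((1 + ‖(2 * Real.pi) • η‖ ^ 2) ^ (l / 2) : ℝ) : ℂ) *
      (𝓕 f : L2 n) η) 2 volume

open Classical in
/-- The Fourier multiplier on `L²(ℝⁿ)` with symbol `m`, i.e. the element of `L²` whose (angular)
Fourier transform is `m(ξ) f̂(ξ)`; here `ξ = 2πη` in the frequency variable `η` of Mathlib's `𝓕`.
(It is `0` if `m f̂` is not square integrable.) -/
def fourierMultiplier {n : ℕ} (m : EuclideanSpace ℝ (Fin n) → ℂ) (f : L2 n) : L2 n :=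
  if h : MemLp (fun η : EuclideanSpace ℝ (Fin n) =>
      m ((2 * Real.pi) • η) * (𝓕 f : L2 n) η) 2 volume
  then (𝓕⁻ (h.toLp _ : L2 n) : L2 n) else 0

/-- The Fourier transform `φ̂(ξ) = (2π)^(-n/2) exp(-τ |ξ|^s)` of the mollifier kernel. -/
def kernelHat (n : ℕ) (τ s : ℝ) (ξ : EuclideanSpace ℝ (Fin n)) : ℝ :=
  (√(2 * Real.pi) ^ n)⁻¹ * Real.exp (-τ * ‖ξ‖ ^ s)

/-- The regularized solution with data `f` and parameter `α`, at time `t`: its Fourier transform is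
`√(2π)ⁿ E_{γ,1}(-|ξ|² t^γ) / E_{γ,1}(-|ξ|² T^γ) φ̂(αξ) f̂(ξ)`. -/
def regularizedSolution {n : ℕ} (γ T τ s α : ℝ) (f : L2 n) (t : ℝ) : L2 n :=
  fourierMultiplier (fun ξ =>
    ((√(2 * Real.pi) ^ n *
      (mittagLeffler γ (-‖ξ‖ ^ 2 * t ^ γ) / mittagLeffler γ (-‖ξ‖ ^ 2 * T ^ γ)) *
      kernelHat n τ s (α • ξ) : ℝ) : ℂ)) f

/-- `u` is a weak solution of `∂^γ u / ∂t^γ = Δ u` on `ℝⁿ × (0,T)`, `u(·,T) = g`: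
`u ∈ C([0,T], L²) ∩ C((0,T], H²)`, the Caputo derivative of the `L²`-valued function `u` exists at
every `t ∈ (0,T)` and equals the (distributional) Laplacian of `u(·,t)`, and `u(·,T) = g`. -/
structure IsWeakSolution {n : ℕ} (γ T : ℝ) (u : ℝ → L2 n) (g : L2 n) : Prop where
  continuousOn : ContinuousOn u (Icc 0 T)
  mem_H2 : ∀ t ∈ Ioc 0 T, sobolevNorm 2 (u t) < ∞
  continuous_H2 : ∀ t₀ ∈ Ioc 0 T,
    Tendsto (fun t => sobolevNorm 2 (u t - u t₀)) (𝓝[Ioc 0 T] t₀) (𝓝 0)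
  differentiableAt : ∀ t ∈ Ioo 0 T, DifferentiableAt ℝ u t
  intervalIntegrable : ∀ t ∈ Ioo 0 T,
    IntervalIntegrable (fun s => (t - s) ^ (-γ) • deriv u s) volume 0 t
  equation : ∀ t ∈ Ioo 0 T,
    ((caputoDeriv γ u t : L2 n) : 𝓢'(EuclideanSpace ℝ (Fin n), ℂ)) =
      Δ ((u t : L2 n) : 𝓢'(EuclideanSpace ℝ (Fin n), ℂ))
  final : u T = g

end FractionalDiffusion

end

open FractionalDiffusion

/-! On the Fourier side the equation reads D^γ û = -|ξ|² û, so û(ξ,t) = E_t û(ξ,0) with E_t =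
E_{γ,1}(-|ξ|²t^γ); in particular ĝ = E_T û(·,0) (`IsWeakSolution.fourier_ae_eq`). Writing q =
exp(-τ|αξ|^s), the error has transform E_t (1-q) û(·,0) + (E_t/E_T) q (ĝ - ĝδ), and
`IsWeakSolution.sobolevNorm_sub_le` reduces everything to pointwise bounds on these two symbols.

Those bounds rest on E_{γ,1}(-x) being comparable to 1/(1+x) for x ≥ 0
(`exists_mittagLeffler_bounds`). Hence E_t is bounded, and is at most a constant times
t^(-γ)/(1+|ξ|²), while E_t/E_T is at most a constant times t^(-γ), or, uniformly in t, times 1+|ξ|².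
The first alternatives with t^(-γ) give part 1, the uniform ones part 2. The approximation error
gains α^(p+2-l) or α^(p-l) from 1-q ≤ (1+τ)(α|ξ|)^ρ, valid for ρ ≤ s; the noise costs α^(-l) or
α^(-(l+2)) because q absorbs the polynomial weight. The chosen α balances the two.

The Mittag-Leffler bounds come from convolution identities for z(t) = t^(γ-1) E_{γ,γ}(-t^γ), once z
> 0 is known. The formula for û cannot be read off at a single frequency, since û is only an a.e.
class; it is derived from the moments ∫_B |ξ|^(2k) û over bounded sets B, which are continuous
functionals of u and form a hierarchy of scalar Caputo equations. -/

namespace FractionalDiffusion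

/-! ### Fractional integration kernels and their semigroup law -/

/-- The kernel `t₊^(a-1) / Γ(a)` of fractional integration of order `a`. -/
noncomputable def powKernel (a t : ℝ) : ℝ :=
  (Ioi (0 : ℝ)).indicator (fun t => t ^ (a - 1) / Real.Gamma a) t

lemma powKernel_of_pos {a t : ℝ} (ht : 0 < t) : powKernel a t = t ^ (a - 1) / Real.Gamma a :=
  indicator_of_mem (mem_Ioi.2 ht) _

lemma powKernel_of_nonpos {a t : ℝ} (ht : t ≤ 0) : powKernel a t = 0 :=
  indicator_of_notMem (by simpa using ht) _

lemma powKernel_pos {a t : ℝ} (ha : 0 < a) (ht : 0 < t) : 0 < powKernel a t := by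
  rw [powKernel_of_pos ht]
  have := Real.Gamma_pos_of_pos ha
  positivity

lemma powKernel_nonneg {a : ℝ} (ha : 0 < a) (t : ℝ) : 0 ≤ powKernel a t := by
  rcases lt_or_ge 0 t with ht | ht
  · exact (powKernel_pos ha ht).le
  · exact (powKernel_of_nonpos ht).ge

lemma measurable_powKernel (a : ℝ) : Measurable (powKernel a) := by
  unfold powKernel
  exact Measurable.indicator (by fun_prop) measurableSet_Ioi

lemma powKernel_one_of_pos {t : ℝ} (ht : 0 < t) : powKernel 1 t = 1 := by
  simp [powKernel_of_pos ht]

/-- Euler's Beta integral scaled to (0,t), with B(b,a) = Γ(b)Γ(a)/Γ(a+b). -/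
lemma integral_powKernel_mul {a b : ℝ} (ha : 0 < a) (hb : 0 < b) (t : ℝ) :
    ∫ s, powKernel a (t - s) * powKernel b s = powKernel (a + b) t := by
  rcases le_or_gt t 0 with ht | ht
  · rw [powKernel_of_nonpos ht, integral_eq_zero_of_ae]
    filter_upwards with s
    rcases le_or_gt s 0 with hs | hs
    · simp [powKernel_of_nonpos hs]
    · simp [powKernel_of_nonpos (show t - s ≤ 0 by linarith)]
  have h1 : (fun s => powKernel a (t - s) * powKernel b s) =
      (Ioo 0 t).indicator
        (fun s => (Real.Gamma a * Real.Gamma b)⁻¹ * (s ^ (b - 1) * (t - s) ^ (a - 1))) := by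
    ext s
    by_cases hs : s ∈ Ioo 0 t
    · rw [indicator_of_mem hs, powKernel_of_pos (sub_pos.2 hs.2), powKernel_of_pos hs.1]
      ring
    · rw [indicator_of_notMem hs]
      rcases le_or_gt s 0 with hs' | hs'
      · simp [powKernel_of_nonpos hs']
      · have : t ≤ s := by
          by_contra h
          exact hs ⟨hs', by linarith⟩
        simp [powKernel_of_nonpos (show t - s ≤ 0 by linarith)]
  have h2 : ∫ s in (0 : ℝ)..t, s ^ (b - 1) * (t - s) ^ (a - 1) =
      t ^ (b + a - 1) * ProbabilityTheory.beta b a := by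
    have h := Complex.betaIntegral_scaled b a ht
    rw [ProbabilityTheory.beta_eq_betaIntegralReal b a hb ha]
    have h3 : ∫ x in (0 : ℝ)..t, (x : ℂ) ^ ((b : ℂ) - 1) * ((t : ℂ) - x) ^ ((a : ℂ) - 1) =
        ((∫ s in (0 : ℝ)..t, s ^ (b - 1) * (t - s) ^ (a - 1) : ℝ) : ℂ) := by
      rw [← intervalIntegral.integral_ofReal]
      refine intervalIntegral.integral_congr fun x hx => ?_
      rw [uIcc_of_le ht.le] at hx
      push_cast [Complex.ofReal_cpow hx.1, Complex.ofReal_cpow (sub_nonneg.2 hx.2)]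
      rfl
    rw [h3] at h
    have h4 : (t : ℂ) ^ ((b : ℂ) + a - 1) = ((t ^ (b + a - 1) : ℝ) : ℂ) := by
      rw [Complex.ofReal_cpow ht.le]; push_cast; rfl
    rw [h4] at h
    have h5 := congrArg Complex.re h
    rwa [Complex.ofReal_re, Complex.re_ofReal_mul] at h5
  rw [h1, integral_indicator measurableSet_Ioo, ← integral_Ioc_eq_integral_Ioo,
    ← intervalIntegral.integral_of_le ht.le, intervalIntegral.integral_const_mul, h2,
    powKernel_of_pos ht, ProbabilityTheory.beta, add_comm b a]
  have := Real.Gamma_pos_of_pos ha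
  have := Real.Gamma_pos_of_pos hb
  have := Real.Gamma_pos_of_pos (add_pos ha hb)
  field_simp

lemma integrable_powKernel_mul {a b : ℝ} (ha : 0 < a) (hb : 0 < b) (t : ℝ) :
    Integrable fun s => powKernel a (t - s) * powKernel b s := by
  rcases le_or_gt t 0 with ht | ht
  · refine (integrable_zero ℝ ℝ volume).congr ?_
    filter_upwards with s
    rcases le_or_gt s 0 with hs | hs
    · simp [powKernel_of_nonpos hs]
    · simp [powKernel_of_nonpos (show t - s ≤ 0 by linarith)]
  -- A non-integrable function has Bochner integral 0, while the value just computed is positive.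
  · by_contra h
    have := integral_undef h
    rw [integral_powKernel_mul ha hb] at this
    exact (powKernel_pos (add_pos ha hb) ht).ne' this

lemma integral_powKernel_mul_shift {a b : ℝ} (ha : 0 < a) (hb : 0 < b) (t r : ℝ) :
    ∫ s, powKernel a (t - s) * powKernel b (s - r) = powKernel (a + b) (t - r) := by
  rw [← integral_powKernel_mul ha hb,
    ← integral_sub_right_eq_self (fun s => powKernel a (t - r - s) * powKernel b s) r]
  simp

lemma integrable_powKernel_mul_shift {a b : ℝ} (ha : 0 < a) (hb : 0 < b) (t r : ℝ) :
    Integrable fun s => powKernel a (t - s) * powKernel b (s - r) := by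
  have := (integrable_powKernel_mul ha hb (t - r)).comp_sub_right r
  refine this.congr ?_
  filter_upwards with s
  simp

section FracInt

variable {F : Type*} [NormedAddCommGroup F] [NormedSpace ℝ F]

/-- The Riemann–Liouville integral of order `a`, based at `-∞`. -/
noncomputable def fracInt (a : ℝ) (f : ℝ → F) (t : ℝ) : F :=
  ∫ s, powKernel a (t - s) • f s

lemma integrable_prod_powKernel {a b t : ℝ} (ha : 0 < a) (hb : 0 < b) {f : ℝ → F}
    (hf : AEStronglyMeasurable f)
    (hi : Integrable fun r => powKernel (a + b) (t - r) • f r) :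
    Integrable (fun z : ℝ × ℝ => (powKernel a (t - z.1) * powKernel b (z.1 - z.2)) • f z.2)
      (volume.prod volume) := by
  have hm := measurable_powKernel a
  have hm' := measurable_powKernel b
  have hmeas : Measurable fun z : ℝ × ℝ => powKernel a (t - z.1) * powKernel b (z.1 - z.2) := by
    fun_prop
  refine (integrable_prod_iff' (hmeas.aestronglyMeasurable.smul hf.comp_snd)).2 ⟨?_, ?_⟩
  · filter_upwards with r
    exact (integrable_powKernel_mul_shift ha hb t r).smul_const (f r)
  · refine hi.norm.congr ?_
    filter_upwards with r
    simp only [Pi.smul_apply', norm_smul]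
    rw [integral_mul_const, ← integral_powKernel_mul_shift ha hb t r]
    congr 1
    rw [Real.norm_of_nonneg]
    · refine integral_congr_ae ?_
      filter_upwards with s
      exact (Real.norm_of_nonneg (mul_nonneg (powKernel_nonneg ha _) (powKernel_nonneg hb _))).symm
    · exact integral_nonneg fun s => mul_nonneg (powKernel_nonneg ha _) (powKernel_nonneg hb _)

/-- A bounded function supported in `(0, ∞)` can be integrated against the kernel. -/
lemma integrable_powKernel_smul_of_bounded {a C : ℝ} (ha : 0 < a) (t : ℝ) {f : ℝ → F}
    (hf : AEStronglyMeasurable f) (hC : ∀ s, ‖f s‖ ≤ C * powKernel 1 s) :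
    Integrable fun s => powKernel a (t - s) • f s := by
  have hm := measurable_powKernel a
  refine ((integrable_powKernel_mul ha one_pos t).const_mul C).mono'
    ((by fun_prop : Measurable fun s => powKernel a (t - s)).aestronglyMeasurable.smul hf) ?_
  filter_upwards with s
  rw [norm_smul, Real.norm_of_nonneg (powKernel_nonneg ha _)]
  calc _ ≤ powKernel a (t - s) * (C * powKernel 1 s) :=
        mul_le_mul_of_nonneg_left (hC s) (powKernel_nonneg ha _)
    _ = _ := by ring

lemma norm_fracInt_le_of_bounded {a C : ℝ} (ha : 0 < a) (t : ℝ) {f : ℝ → F}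
    (hC : ∀ s, ‖f s‖ ≤ C * powKernel 1 s) :
    ‖fracInt a f t‖ ≤ C * powKernel (a + 1) t := by
  rw [← integral_powKernel_mul ha one_pos, ← integral_const_mul]
  refine norm_integral_le_of_norm_le ((integrable_powKernel_mul ha one_pos t).const_mul C) ?_
  filter_upwards with s
  rw [norm_smul, Real.norm_of_nonneg (powKernel_nonneg ha _)]
  calc _ ≤ powKernel a (t - s) * (C * powKernel 1 s) :=
        mul_le_mul_of_nonneg_left (hC s) (powKernel_nonneg ha _)
    _ = _ := by ring

lemma integrable_powKernel_smul_fracInt {a b t : ℝ} (ha : 0 < a) (hb : 0 < b) {f : ℝ → F}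
    (hf : AEStronglyMeasurable f)
    (hi : Integrable fun r => powKernel (a + b) (t - r) • f r) :
    Integrable fun s => powKernel a (t - s) • fracInt b f s := by
  refine (integrable_prod_powKernel ha hb hf hi).integral_prod_left.congr ?_
  filter_upwards with s
  simp_rw [fracInt, ← integral_smul, smul_smul]

variable [CompleteSpace F]

/-- The semigroup law of fractional integration. -/
lemma fracInt_fracInt {a b t : ℝ} (ha : 0 < a) (hb : 0 < b) {f : ℝ → F}
    (hf : AEStronglyMeasurable f)
    (hi : Integrable fun r => powKernel (a + b) (t - r) • f r) :
    fracInt a (fracInt b f) t = fracInt (a + b) f t := by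
  have h := integrable_prod_powKernel ha hb hf hi
  calc fracInt a (fracInt b f) t
      = ∫ s, ∫ r, (powKernel a (t - s) * powKernel b (s - r)) • f r := by
        simp_rw [fracInt, ← integral_smul, smul_smul]
    _ = ∫ r, ∫ s, (powKernel a (t - s) * powKernel b (s - r)) • f r := integral_integral_swap h
    _ = fracInt (a + b) f t := by
        simp_rw [fracInt]
        refine integral_congr_ae ?_
        filter_upwards with r
        rw [← integral_powKernel_mul_shift ha hb, integral_smul_const]

lemma fracInt_powKernel_one_smul {a : ℝ} (ha : 0 < a) (t : ℝ) (c : F) :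
    fracInt a (fun s => powKernel 1 s • c) t = powKernel (a + 1) t • c := by
  simp_rw [fracInt, smul_smul, integral_smul_const, integral_powKernel_mul ha one_pos]

end FracInt

/-! ### Mittag-Leffler series and their convolution identities -/

/-- Keep only the part of Euler's integral over (A,∞), where t^(x-1) ≥ A^(x-1). As A is free, Γ
outgrows every geometric sequence. -/
lemma rpow_mul_exp_neg_le_Gamma {A x : ℝ} (hA : 0 < A) (hx : 1 ≤ x) :
    A ^ (x - 1) * Real.exp (-A) ≤ Real.Gamma x := by
  have hx0 : 0 < x := by linarith
  rw [Real.Gamma_eq_integral hx0, ← integral_exp_neg_Ioi A, ← integral_const_mul]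
  have hint := Real.GammaIntegral_convergent hx0
  have hsub : Ioi A ⊆ Ioi 0 := Ioi_subset_Ioi hA.le
  calc ∫ t in Ioi A, A ^ (x - 1) * Real.exp (-t)
      ≤ ∫ t in Ioi A, Real.exp (-t) * t ^ (x - 1) := by
        refine setIntegral_mono_on ((integrableOn_exp_neg_Ioi A).const_mul _) (hint.mono_set hsub)
          measurableSet_Ioi fun t ht => ?_
        rw [mul_comm]
        gcongr
        exact (mem_Ioi.1 ht).le
    _ ≤ ∫ t in Ioi 0, Real.exp (-t) * t ^ (x - 1) := by
        refine setIntegral_mono_set hint ?_ hsub.eventuallyLE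
        filter_upwards [ae_restrict_mem measurableSet_Ioi] with t ht
        have := mem_Ioi.1 ht
        simp only [Pi.zero_apply]
        positivity

lemma summable_pow_div_Gamma {γ : ℝ} (hγ : 0 < γ) (b R : ℝ) :
    Summable fun k : ℕ => R ^ k / Real.Gamma (γ * k + b) := by
  -- Chosen so that A^γ = 2|R|+1, which makes the terms eventually geometric with ratio |R|/(2|R|+1)
  -- < 1.
  set A : ℝ := (2 * |R| + 1) ^ (1 / γ) with hA
  have hA0 : 0 < A := by positivity
  have hAγ : A ^ γ = 2 * |R| + 1 := by
    rw [hA, ← Real.rpow_mul (by positivity), one_div_mul_cancel hγ.ne', Real.rpow_one]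
  have hr : |R| / (2 * |R| + 1) < 1 := by
    rw [div_lt_one (by positivity)]
    linarith [abs_nonneg R]
  refine Summable.of_norm_bounded_eventually_nat
    (g := fun k => Real.exp A * A ^ (1 - b) * (|R| / (2 * |R| + 1)) ^ k)
    ((summable_geometric_of_lt_one (by positivity) hr).mul_left _) ?_
  have h1 : Tendsto (fun k : ℕ => γ * (k : ℝ) + b) atTop atTop :=
    tendsto_atTop_add_const_right _ _ (tendsto_natCast_atTop_atTop.const_mul_atTop hγ)
  filter_upwards [h1.eventually_ge_atTop 1] with k hk
  have hG := rpow_mul_exp_neg_le_Gamma hA0 hk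
  have hG0 : 0 < Real.Gamma (γ * k + b) := Real.Gamma_pos_of_pos (by linarith)
  rw [norm_div, norm_pow, Real.norm_eq_abs, Real.norm_of_nonneg hG0.le, div_le_iff₀ hG0]
  have h2 : A ^ (γ * (k : ℝ) + b - 1) = (2 * |R| + 1) ^ k * A ^ (b - 1) := by
    rw [← hAγ, ← Real.rpow_natCast (A ^ γ), ← Real.rpow_mul hA0.le, ← Real.rpow_add hA0]
    ring_nf
  calc |R| ^ k = Real.exp A * A ^ (1 - b) * (|R| / (2 * |R| + 1)) ^ k *
        ((2 * |R| + 1) ^ k * A ^ (b - 1) * Real.exp (-A)) := by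
        rw [div_pow, Real.exp_neg, show 1 - b = -(b - 1) by ring, Real.rpow_neg hA0.le]
        have := (Real.rpow_pos_of_pos hA0 (b - 1)).ne'
        have h3 : (2 * |R| + 1) ^ k ≠ 0 := by positivity
        field_simp
    _ ≤ _ := by
        rw [← h2]
        gcongr

/-- The two-parameter Mittag-Leffler function. -/
noncomputable def mittagLefflerTwo (γ b z : ℝ) : ℝ :=
  ∑' k : ℕ, z ^ k / Real.Gamma (γ * k + b)

/-- Termwise differentiation on a ball of radius R ≥ 1: k|y|^(k-1) ≤ (2R)^k, so the series at 2R
dominates the derivatives. -/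
lemma differentiable_mittagLefflerTwo {γ b : ℝ} (hγ : 0 < γ) (hb : 0 < b) :
    Differentiable ℝ (mittagLefflerTwo γ b) := by
  intro x
  set R : ℝ := |x| + 1 with hR
  have hR1 : 1 ≤ R := by linarith [abs_nonneg x]
  have hx : x ∈ Metric.ball (0 : ℝ) R := by simp [hR]
  refine (hasDerivAt_tsum_of_isPreconnected (summable_pow_div_Gamma hγ b (2 * R))
    (g' := fun (k : ℕ) y => (k * y ^ (k - 1)) / Real.Gamma (γ * k + b)) Metric.isOpen_ball
    (convex_ball (0 : ℝ) R).isPreconnected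
    (fun k y _ => (hasDerivAt_pow k y).div_const _) (fun k y hy => ?_) (y₀ := 0)
    (by simp; linarith) (summable_pow_div_Gamma hγ b 0) hx).differentiableAt
  have hy' : |y| ≤ R := by simpa using (mem_ball_zero_iff.1 hy).le
  have hG : 0 < Real.Gamma (γ * k + b) := Real.Gamma_pos_of_pos (by positivity)
  rw [norm_div, Real.norm_of_nonneg hG.le, norm_mul, norm_pow, Real.norm_eq_abs, Real.norm_eq_abs,
    Nat.abs_cast]
  gcongr
  rw [mul_pow]
  gcongr
  · exact_mod_cast Nat.lt_two_pow_self.le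
  · calc |y| ^ (k - 1) ≤ R ^ (k - 1) := by gcongr
      _ ≤ R ^ k := pow_le_pow_right₀ hR1 (Nat.sub_le k 1)

/-- The function `t₊^(b-1) E_{γ,b}(-t^γ)`. -/
noncomputable def mlKernel (γ b t : ℝ) : ℝ :=
  (Ioi (0 : ℝ)).indicator (fun t => t ^ (b - 1) * mittagLefflerTwo γ b (-t ^ γ)) t

lemma mlKernel_of_pos {γ b t : ℝ} (ht : 0 < t) :
    mlKernel γ b t = t ^ (b - 1) * mittagLefflerTwo γ b (-t ^ γ) :=
  indicator_of_mem (mem_Ioi.2 ht) _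

lemma mlKernel_of_nonpos {γ b t : ℝ} (ht : t ≤ 0) : mlKernel γ b t = 0 :=
  indicator_of_notMem (by simpa using ht) _

lemma powKernel_mul_add {γ b t : ℝ} (ht : 0 < t) (k : ℕ) :
    powKernel (γ * k + b) t = t ^ (b - 1) * ((t ^ γ) ^ k / Real.Gamma (γ * k + b)) := by
  rw [powKernel_of_pos ht, ← Real.rpow_natCast, ← Real.rpow_mul ht.le, ← mul_div_assoc,
    ← Real.rpow_add ht]
  ring_nf

lemma summable_powKernel {γ : ℝ} (hγ : 0 < γ) (b t : ℝ) :
    Summable fun k : ℕ => powKernel (γ * k + b) t := by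
  rcases le_or_gt t 0 with ht | ht
  · simp [powKernel_of_nonpos ht, summable_zero]
  · simp_rw [powKernel_mul_add ht]
    exact (summable_pow_div_Gamma hγ b _).mul_left _

lemma hasSum_mlKernel {γ : ℝ} (hγ : 0 < γ) (b t : ℝ) :
    HasSum (fun k : ℕ => (-1) ^ k * powKernel (γ * k + b) t) (mlKernel γ b t) := by
  rcases le_or_gt t 0 with ht | ht
  · simp [powKernel_of_nonpos ht, mlKernel_of_nonpos ht, hasSum_zero]
  · rw [mlKernel_of_pos ht]
    have := ((summable_pow_div_Gamma hγ b (-t ^ γ)).hasSum).mul_left (t ^ (b - 1))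
    refine this.congr_fun fun k => ?_
    rw [powKernel_mul_add ht, neg_pow]
    ring

lemma measurable_mlKernel {γ b : ℝ} (hγ : 0 < γ) (hb : 0 < b) : Measurable (mlKernel γ b) := by
  have := (differentiable_mittagLefflerTwo hγ hb).continuous.measurable
  unfold mlKernel
  exact Measurable.indicator (by fun_prop) measurableSet_Ioi

lemma differentiableAt_mlKernel {γ b t : ℝ} (hγ : 0 < γ) (hb : 0 < b) (ht : 0 < t) :
    DifferentiableAt ℝ (mlKernel γ b) t := by
  have h := differentiable_mittagLefflerTwo hγ hb
  have h1 : DifferentiableAt ℝ (fun t : ℝ => t ^ (b - 1) * mittagLefflerTwo γ b (-t ^ γ)) t := by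
    have h2 : DifferentiableAt ℝ (fun t : ℝ => t ^ γ) t :=
      (Real.hasDerivAt_rpow_const (Or.inl ht.ne')).differentiableAt
    have h3 : DifferentiableAt ℝ (fun t : ℝ => t ^ (b - 1)) t :=
      (Real.hasDerivAt_rpow_const (Or.inl ht.ne')).differentiableAt
    exact h3.mul (h.differentiableAt.comp t h2.neg)
  refine h1.congr_of_eventuallyEq ?_
  filter_upwards [lt_mem_nhds ht] with s hs using mlKernel_of_pos hs

lemma abs_mlKernel_le {γ b t s : ℝ} (hγ : 0 < γ) (hb : 0 < b) (hs : s ≤ t) :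
    |mlKernel γ b s| ≤ (Real.Gamma b * ∑' k : ℕ, (t ^ γ) ^ k / Real.Gamma (γ * k + b)) *
      powKernel b s := by
  rcases le_or_gt s 0 with hs0 | hs0
  · simp [mlKernel_of_nonpos hs0, powKernel_of_nonpos hs0]
  have hG (k : ℕ) : 0 < Real.Gamma (γ * k + b) := Real.Gamma_pos_of_pos (by positivity)
  have hGb : 0 < Real.Gamma b := Real.Gamma_pos_of_pos hb
  have h1 : |mittagLefflerTwo γ b (-s ^ γ)| ≤ ∑' k : ℕ, (t ^ γ) ^ k / Real.Gamma (γ * k + b) := by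
    rw [← Real.norm_eq_abs]
    refine tsum_of_norm_bounded (summable_pow_div_Gamma hγ b _).hasSum fun k => ?_
    rw [norm_div, norm_pow, norm_neg, Real.norm_of_nonneg (hG k).le,
      Real.norm_of_nonneg (by positivity)]
    have := hG k
    gcongr
  rw [mlKernel_of_pos hs0, powKernel_of_pos hs0, abs_mul, abs_of_nonneg (by positivity)]
  calc _ ≤ s ^ (b - 1) * ∑' k : ℕ, (t ^ γ) ^ k / Real.Gamma (γ * k + b) := by gcongr
    _ = _ := by field_simp

lemma integrable_powKernel_mul_mlKernel {γ a b : ℝ} (hγ : 0 < γ) (ha : 0 < a) (hb : 0 < b)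
    (t : ℝ) : Integrable fun s => powKernel a (t - s) * mlKernel γ b s := by
  have h1 := measurable_powKernel a
  have h2 := measurable_mlKernel hγ hb
  set C := Real.Gamma b * ∑' k : ℕ, (t ^ γ) ^ k / Real.Gamma (γ * k + b)
  refine ((integrable_powKernel_mul ha hb t).const_mul C).mono'
    (by fun_prop : Measurable fun s => powKernel a (t - s) * mlKernel γ b s).aestronglyMeasurable ?_
  filter_upwards with s
  rw [norm_mul, Real.norm_of_nonneg (powKernel_nonneg ha _)]
  rcases le_or_gt t s with hs | hs
  · simp [powKernel_of_nonpos (sub_nonpos.2 hs)]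
  · calc _ ≤ powKernel a (t - s) * (C * powKernel b s) :=
        mul_le_mul_of_nonneg_left (abs_mlKernel_le hγ hb hs.le) (powKernel_nonneg ha _)
      _ = _ := by ring

/-- Convolve the series of `hasSum_mlKernel` term by term: each index γk+b is raised by a. The
integrals of the absolute values are again terms of a convergent series. -/
lemma integral_powKernel_mul_mlKernel {γ a b : ℝ} (hγ : 0 < γ) (ha : 0 < a) (hb : 0 < b)
    (t : ℝ) : ∫ s, powKernel a (t - s) * mlKernel γ b s = mlKernel γ (a + b) t := by
  have hk (k : ℕ) : 0 < γ * k + b := by positivity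
  have h1 (k : ℕ) : Integrable fun s => (-1) ^ k * (powKernel a (t - s) * powKernel (γ * k + b) s) :=
    (integrable_powKernel_mul ha (hk k) t).const_mul _
  have h2 (k : ℕ) : ∫ s, ‖(-1) ^ k * (powKernel a (t - s) * powKernel (γ * k + b) s)‖ =
      powKernel (γ * k + (a + b)) t := by
    rw [show γ * k + (a + b) = a + (γ * k + b) by ring, ← integral_powKernel_mul ha (hk k)]
    congr 1 with s
    rw [norm_mul, norm_pow, norm_neg, norm_one, one_pow, one_mul, Real.norm_of_nonneg]
    exact mul_nonneg (powKernel_nonneg ha _) (powKernel_nonneg (hk k) _)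
  have h3 := hasSum_integral_of_summable_integral_norm h1
    (by simp_rw [h2]; exact summable_powKernel hγ _ t)
  have h4 (s : ℝ) : ∑' k : ℕ, (-1) ^ k * (powKernel a (t - s) * powKernel (γ * k + b) s) =
      powKernel a (t - s) * mlKernel γ b s := by
    rw [← ((hasSum_mlKernel hγ b s).mul_left (powKernel a (t - s))).tsum_eq]
    congr 1 with k
    ring
  simp_rw [h4, integral_const_mul, integral_powKernel_mul ha (hk _),
    fun k : ℕ => show a + (γ * k + b) = γ * k + (a + b) by ring] at h3
  exact h3.unique (hasSum_mlKernel hγ (a + b) t)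

/-- Removing the term k = 0, equal to 1, from the alternating series with b = 1 leaves the series
with b = γ+1 and the opposite sign. -/
lemma mlKernel_add_one {γ t : ℝ} (hγ : 0 < γ) (ht : 0 < t) :
    mlKernel γ (γ + 1) t = 1 - mlKernel γ 1 t := by
  have h1 := (hasSum_nat_add_iff' 1).2 (hasSum_mlKernel hγ 1 t)
  have h2 := (hasSum_mlKernel hγ (γ + 1) t).neg
  have h3 : mlKernel γ 1 t - 1 = -mlKernel γ (γ + 1) t := by
    refine HasSum.unique ?_ h2
    convert h1 using 1
    · ext k
      push_cast
      rw [show γ * ((k : ℝ) + 1) + 1 = γ * k + (γ + 1) by ring]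
      ring
    · simp [powKernel_one_of_pos ht]
  linarith

/-! ### Positivity of t^(γ-1) E_{γ,γ}(-t^γ) -/

lemma powKernel_anti {γ x y : ℝ} (hγ₀ : 0 < γ) (hγ₁ : γ < 1) (hx : 0 < x) (hxy : x ≤ y) :
    powKernel (1 - γ) y ≤ powKernel (1 - γ) x := by
  have hG : 0 < Real.Gamma (1 - γ) := Real.Gamma_pos_of_pos (by linarith)
  rw [powKernel_of_pos hx, powKernel_of_pos (hx.trans_le hxy)]
  gcongr ?_ / _
  exact Real.rpow_le_rpow_of_nonpos hx hxy (by linarith)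

/-- The singular kernel decreases at a definite rate on bounded intervals. -/
lemma powKernel_add_le {γ x h T : ℝ} (hγ₀ : 0 < γ) (hγ₁ : γ < 1) (hx : 0 < x) (hh : 0 < h)
    (hT : x + h ≤ T) :
    powKernel (1 - γ) (x + h) ≤
      powKernel (1 - γ) x - γ * T ^ (-γ - 1) / Real.Gamma (1 - γ) * h := by
  have hG : 0 < Real.Gamma (1 - γ) := Real.Gamma_pos_of_pos (by linarith)
  obtain ⟨c, hc, hc'⟩ := exists_hasDerivAt_eq_slope (fun y : ℝ => y ^ (-γ))
    (fun y => -γ * y ^ (-γ - 1)) (show x < x + h by linarith)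
    (fun y hy => (Real.continuousAt_rpow_const _ _
      (Or.inl (hx.trans_le hy.1).ne')).continuousWithinAt)
    (fun y hy => Real.hasDerivAt_rpow_const (Or.inl (hx.trans hy.1).ne'))
  rw [add_sub_cancel_left, eq_div_iff hh.ne'] at hc'
  have h1 : T ^ (-γ - 1) ≤ c ^ (-γ - 1) :=
    Real.rpow_le_rpow_of_nonpos (hx.trans hc.1) (hc.2.le.trans hT) (by linarith)
  have h2 : (x + h) ^ (-γ) ≤ x ^ (-γ) - γ * T ^ (-γ - 1) * h := by
    have : γ * T ^ (-γ - 1) * h ≤ γ * c ^ (-γ - 1) * h := by gcongr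
    linarith
  rw [powKernel_of_pos hx, powKernel_of_pos (by linarith), show 1 - γ - 1 = -γ by ring]
  calc _ ≤ (x ^ (-γ) - γ * T ^ (-γ - 1) * h) / Real.Gamma (1 - γ) := by gcongr
    _ = _ := by ring

lemma integrable_indicator_mlKernel {γ b t : ℝ} (hγ : 0 < γ) (hb : 0 < b) {s : Set ℝ}
    (hs : MeasurableSet s) (hst : s ⊆ Iio t) : Integrable (s.indicator (mlKernel γ b)) := by
  refine ((integrable_powKernel_mul_mlKernel hγ one_pos hb t).indicator hs).congr ?_
  filter_upwards with x
  by_cases hx : x ∈ s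
  · simp [hx, powKernel_one_of_pos (sub_pos.2 (mem_Iio.1 (hst hx)))]
  · simp [hx]

/-- There is no first zero of `t^(γ-1) E_{γ,γ}(-t^γ)`. -/
lemma mlKernel_pos_of_pos_on {γ t₀ : ℝ} (hγ₀ : 0 < γ) (hγ₁ : γ < 1) (ht₀ : 0 < t₀)
    (hpos : ∀ t ∈ Ioo 0 t₀, 0 < mlKernel γ γ t) : 0 < mlKernel γ γ t₀ := by
  by_contra! hneg
  set z := mlKernel γ γ with hz
  have hc : 0 < 1 - γ := by linarith
  obtain ⟨C, hC0, hC⟩ := (differentiableAt_mlKernel hγ₀ hγ₀ ht₀).hasDerivAt.isBigO_sub.exists_pos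
  obtain ⟨ε, hε, hball⟩ := Metric.eventually_nhds_iff.1 hC.bound
  -- Differentiability at t₀ together with z(t₀) ≤ 0 bounds z linearly just before t₀.
  have hlip : ∀ s, t₀ - s < ε → s < t₀ → z s ≤ C * (t₀ - s) := by
    intro s hs hs'
    have h1 := hball (y := s) (by rw [dist_comm, Real.dist_eq, abs_of_pos] <;> linarith)
    rw [Real.norm_eq_abs, Real.norm_eq_abs, abs_sub_comm s, abs_of_pos (sub_pos.2 hs')] at h1
    linarith [le_abs_self (z s - z t₀)]
  set G := Real.Gamma (1 - γ) with hGdef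
  have hG : 0 < G := Real.Gamma_pos_of_pos hc
  set κ : ℝ := γ * t₀ ^ (-γ - 1) / G with hκ
  have hκ0 : 0 < κ := by positivity
  set m : ℝ := ∫ s, (Ioo 0 (t₀ / 2)).indicator z s with hm
  have hzint : Integrable ((Ioo 0 (t₀ / 2)).indicator z) :=
    integrable_indicator_mlKernel hγ₀ hγ₀ measurableSet_Ioo Ioo_subset_Iio_self
  have hm0 : 0 < m := by
    rw [hm, integral_indicator measurableSet_Ioo,
      setIntegral_pos_iff_support_of_nonneg_ae]
    · have : Function.support z ∩ Ioo 0 (t₀ / 2) = Ioo 0 (t₀ / 2) := by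
        refine inter_eq_right.2 fun s hs => (hpos s ⟨hs.1, ?_⟩).ne'
        linarith [hs.2]
      rw [this]
      simp [ht₀]
    · filter_upwards [ae_restrict_mem measurableSet_Ioo] with s hs
      exact (hpos s ⟨hs.1, by linarith [hs.2]⟩).le
    · exact (integrable_indicator_iff measurableSet_Ioo).1 hzint
  -- Compare the identity (k_{1-γ} + 1) * z = 1 at the times t₀ and t₀ - h. The recent past [t₀-h,
  -- t₀) contributes at most h·D, because z is small there; the older past loses at least κhm,
  -- because k_{1-γ} is strictly decreasing. The two total contributions are equal, so κm ≤ D, and D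
  -- → 0 with h although κm > 0.
  have key : ∀ h, 0 < h → h < ε → h < t₀ / 2 →
      κ * m ≤ C * (h ^ (1 - γ) / G + h) := by
    intro h hh hhε hht
    set D : ℝ := C * (h ^ (1 - γ) / G + h) with hD
    have hsum : ∀ t, 0 < t →
        ∫ s, (powKernel (1 - γ) (t - s) * z s + powKernel 1 (t - s) * z s) = 1 := by
      intro t ht
      rw [integral_add (integrable_powKernel_mul_mlKernel hγ₀ hc hγ₀ t)
        (integrable_powKernel_mul_mlKernel hγ₀ one_pos hγ₀ t),
        integral_powKernel_mul_mlKernel hγ₀ hc hγ₀, integral_powKernel_mul_mlKernel hγ₀ one_pos hγ₀,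
        add_comm 1 γ, mlKernel_add_one hγ₀ ht]
      ring_nf
    have hi (t : ℝ) := (integrable_powKernel_mul_mlKernel hγ₀ hc hγ₀ t).add
      (integrable_powKernel_mul_mlKernel hγ₀ one_pos hγ₀ t)
    have hdiff : ∫ s, ((powKernel (1 - γ) (t₀ - s) * z s + powKernel 1 (t₀ - s) * z s) -
        (powKernel (1 - γ) (t₀ - h - s) * z s + powKernel 1 (t₀ - h - s) * z s)) = 0 := by
      have := integral_sub (hi t₀) (hi (t₀ - h))
      simp only [Pi.add_apply] at this
      rw [this, hsum _ ht₀, hsum _ (by linarith), sub_self]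
    have hind : Integrable ((Ico (t₀ - h) t₀).indicator fun _ : ℝ => D) :=
      (integrable_indicator_iff measurableSet_Ico).2 (integrableOn_const (by simp))
    have hbound : ∀ s, (powKernel (1 - γ) (t₀ - s) * z s + powKernel 1 (t₀ - s) * z s) -
        (powKernel (1 - γ) (t₀ - h - s) * z s + powKernel 1 (t₀ - h - s) * z s) ≤
        (Ico (t₀ - h) t₀).indicator (fun _ => D) s -
          κ * h * (Ioo 0 (t₀ / 2)).indicator z s := by
      intro s
      rcases le_or_gt s 0 with hs0 | hs0
      · have h1 : s ∉ Ico (t₀ - h) t₀ := fun hs => by linarith [hs.1]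
        have h2 : s ∉ Ioo 0 (t₀ / 2) := fun hs => by linarith [hs.1]
        simp [hz, mlKernel_of_nonpos hs0, h1, h2]
      rcases le_or_gt t₀ s with hs1 | hs1
      · have h1 : s ∉ Ico (t₀ - h) t₀ := fun hs => by linarith [hs.2]
        have h2 : s ∉ Ioo 0 (t₀ / 2) := fun hs => by linarith [hs.2]
        simp [h1, h2, powKernel_of_nonpos (sub_nonpos.2 hs1),
          powKernel_of_nonpos (show t₀ - h - s ≤ 0 by linarith)]
      have hzs : 0 < z s := hpos s ⟨hs0, hs1⟩
      rcases le_or_gt (t₀ - h) s with hs2 | hs2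
      · have h1 : s ∈ Ico (t₀ - h) t₀ := ⟨hs2, hs1⟩
        have h2 : s ∉ Ioo 0 (t₀ / 2) := fun hs => by linarith [hs.2]
        rw [indicator_of_mem h1, indicator_of_notMem h2,
          powKernel_of_nonpos (show t₀ - h - s ≤ 0 by linarith),
          powKernel_of_nonpos (show t₀ - h - s ≤ 0 by linarith),
          powKernel_one_of_pos (sub_pos.2 hs1), powKernel_of_pos (sub_pos.2 hs1)]
        have hx : 0 < t₀ - s := sub_pos.2 hs1
        have h3 : z s ≤ C * (t₀ - s) := hlip s (by linarith) hs1
        have h4 : (t₀ - s) ^ (1 - γ - 1) * (t₀ - s) = (t₀ - s) ^ (1 - γ) := by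
          rw [← Real.rpow_add_one hx.ne']
          ring_nf
        have h5 : (t₀ - s) ^ (1 - γ) ≤ h ^ (1 - γ) :=
          Real.rpow_le_rpow hx.le (by linarith) hc.le
        calc _ = ((t₀ - s) ^ (1 - γ - 1) / G + 1) * z s := by ring
          _ ≤ ((t₀ - s) ^ (1 - γ - 1) / G + 1) * (C * (t₀ - s)) := by gcongr
          _ = C * ((t₀ - s) ^ (1 - γ - 1) * (t₀ - s) / G + (t₀ - s)) := by ring
          _ ≤ C * (h ^ (1 - γ) / G + h) := by
            rw [h4]
            gcongr
            linarith
          _ = _ := by ring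
      · have h1 : s ∉ Ico (t₀ - h) t₀ := fun hs => by linarith [hs.1]
        rw [indicator_of_notMem h1, powKernel_one_of_pos (sub_pos.2 hs1),
          powKernel_one_of_pos (sub_pos.2 hs2)]
        have h3 := powKernel_add_le hγ₀ hγ₁ (sub_pos.2 hs2) hh
          (show t₀ - h - s + h ≤ t₀ by linarith)
        rw [show t₀ - h - s + h = t₀ - s by ring] at h3
        have h4 : (Ioo 0 (t₀ / 2)).indicator z s ≤ z s :=
          indicator_apply_le' (fun _ => le_rfl) (fun _ => hzs.le)
        calc _ = (powKernel (1 - γ) (t₀ - s) - powKernel (1 - γ) (t₀ - h - s)) * z s := by ring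
          _ ≤ -(κ * h) * z s := by
            gcongr
            linarith
          _ = -(κ * h * z s) := by ring
          _ ≤ -(κ * h * (Ioo 0 (t₀ / 2)).indicator z s) := by gcongr
          _ = _ := by ring
    have hle := integral_mono ((hi t₀).sub (hi (t₀ - h))) (hind.sub (hzint.const_mul (κ * h)))
      hbound
    simp only [Pi.sub_apply, Pi.add_apply] at hle
    rw [hdiff, integral_sub hind (hzint.const_mul (κ * h)), integral_const_mul,
      integral_indicator measurableSet_Ico, setIntegral_const, measureReal_def, Real.volume_Ico,
      ENNReal.toReal_ofReal (by linarith), ← hm, smul_eq_mul] at hle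
    have : h * (κ * m) ≤ h * D := by linarith
    exact le_of_mul_le_mul_left this hh
  have hlim : Tendsto (fun h : ℝ => C * (h ^ (1 - γ) / G + h)) (𝓝[>] 0) (𝓝 0) := by
    have h1 : Tendsto (fun h : ℝ => h ^ (1 - γ)) (𝓝 0) (𝓝 0) := by
      simpa [Real.zero_rpow hc.ne'] using
        (Real.continuousAt_rpow_const 0 (1 - γ) (Or.inr hc.le)).tendsto
    have h2 : Tendsto (fun h : ℝ => C * (h ^ (1 - γ) / G + h)) (𝓝 0) (𝓝 (C * (0 / G + 0))) :=
      ((h1.div_const G).add tendsto_id).const_mul C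
    simp only [zero_div, add_zero, mul_zero] at h2
    exact h2.mono_left nhdsWithin_le_nhds
  have hle : κ * m ≤ 0 := by
    refine ge_of_tendsto hlim ?_
    filter_upwards [self_mem_nhdsWithin, nhdsWithin_le_nhds (gt_mem_nhds hε),
      nhdsWithin_le_nhds (gt_mem_nhds (half_pos ht₀))] with h h1 h2 h3 using key h h1 h2 h3
  linarith [mul_pos hκ0 hm0]

lemma mittagLefflerTwo_zero {γ b : ℝ} : mittagLefflerTwo γ b 0 = (Real.Gamma b)⁻¹ := by
  rw [mittagLefflerTwo, tsum_eq_single 0]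
  · simp
  · intro k hk
    simp [hk]

theorem mlKernel_pos {γ t : ℝ} (hγ₀ : 0 < γ) (hγ₁ : γ < 1) (ht : 0 < t) :
    0 < mlKernel γ γ t := by
  have hcont : ContinuousOn (mlKernel γ γ) (Ioi 0) := fun s hs =>
    (differentiableAt_mlKernel hγ₀ hγ₀ hs).continuousAt.continuousWithinAt
  have hsmall : ∀ᶠ s in 𝓝[>] (0 : ℝ), 0 < mlKernel γ γ s := by
    have h1 : Tendsto (fun s : ℝ => mittagLefflerTwo γ γ (-s ^ γ)) (𝓝 0)
        (𝓝 (Real.Gamma γ)⁻¹) := by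
      have h2 : ContinuousAt (fun s : ℝ => mittagLefflerTwo γ γ (-s ^ γ)) 0 :=
        (differentiable_mittagLefflerTwo hγ₀ hγ₀).continuous.continuousAt.comp
          (Real.continuousAt_rpow_const 0 γ (Or.inr hγ₀.le)).neg
      simpa [ContinuousAt, Real.zero_rpow hγ₀.ne', mittagLefflerTwo_zero] using h2
    have h3 := h1.eventually (lt_mem_nhds (inv_pos.2 (Real.Gamma_pos_of_pos hγ₀)))
    filter_upwards [self_mem_nhdsWithin, nhdsWithin_le_nhds h3] with s hs hs'
    rw [mlKernel_of_pos hs]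
    exact mul_pos (Real.rpow_pos_of_pos hs _) hs'
  obtain ⟨ε, hε, hεpos⟩ := mem_nhdsGT_iff_exists_Ioc_subset.1 hsmall
  by_contra! hneg
  have hεt : ε < t := by
    by_contra! h
    exact absurd (hεpos ⟨ht, h⟩) (not_lt.2 hneg)
  have hcompact : IsCompact (Icc ε t ∩ mlKernel γ γ ⁻¹' Iic 0) := by
    refine isCompact_Icc.of_isClosed_subset ?_ inter_subset_left
    exact (hcont.mono fun s hs => mem_Ioi.2 ((mem_Ioi.1 hε).trans_le hs.1)).preimage_isClosed_of_isClosed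
      isClosed_Icc isClosed_Iic
  -- The earliest time with z ≤ 0: it exists by compactness, since z > 0 on (0,ε].
  obtain ⟨t₀, ⟨ht₀, ht₀'⟩, hmin⟩ := hcompact.exists_isLeast ⟨t, ⟨hεt.le, le_rfl⟩, hneg⟩
  refine absurd (mlKernel_pos_of_pos_on hγ₀ hγ₁ ((mem_Ioi.1 hε).trans_le ht₀.1) fun s hs => ?_)
    (not_lt.2 ht₀')
  by_contra! hs'
  rcases le_or_gt s ε with h | h
  · exact absurd (hεpos ⟨hs.1, h⟩) (not_lt.2 hs')
  · exact absurd (hmin ⟨⟨h.le, hs.2.le.trans ht₀.2⟩, hs'⟩) (not_le.2 hs.2)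

lemma mlKernel_nonneg {γ : ℝ} (hγ₀ : 0 < γ) (hγ₁ : γ < 1) (t : ℝ) : 0 ≤ mlKernel γ γ t := by
  rcases le_or_gt t 0 with ht | ht
  · exact (mlKernel_of_nonpos ht).ge
  · exact (mlKernel_pos hγ₀ hγ₁ ht).le

/-! ### Two-sided Mittag-Leffler bounds -/

/-- E_{γ,1}(-t^γ) = (k_{1-γ} * z)(t). Since k_{1-γ} decreases and z ≥ 0, this is at least k_{1-γ}(t)
∫₀ᵗ z, and ∫₀ᵗ z = 1 - E_{γ,1}(-t^γ). It yields the lower bound. -/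
lemma powKernel_mul_one_sub_le {γ t : ℝ} (hγ₀ : 0 < γ) (hγ₁ : γ < 1) (ht : 0 < t) :
    powKernel (1 - γ) t * (1 - mlKernel γ 1 t) ≤ mlKernel γ 1 t := by
  have hc : 0 < 1 - γ := by linarith
  have h1 := integral_powKernel_mul_mlKernel hγ₀ hc hγ₀ t
  have h2 := integral_powKernel_mul_mlKernel hγ₀ one_pos hγ₀ t
  rw [sub_add_cancel] at h1
  rw [← mlKernel_add_one hγ₀ ht, add_comm γ 1, ← h1, ← h2, ← integral_const_mul]
  refine integral_mono ((integrable_powKernel_mul_mlKernel hγ₀ one_pos hγ₀ t).const_mul _)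
    (integrable_powKernel_mul_mlKernel hγ₀ hc hγ₀ t) fun s => ?_
  rcases le_or_gt s 0 with hs | hs
  · simp [mlKernel_of_nonpos hs]
  rcases le_or_gt t s with hts | hts
  · simp [powKernel_of_nonpos (sub_nonpos.2 hts)]
  · have := mlKernel_pos hγ₀ hγ₁ hs
    simp only [powKernel_one_of_pos (sub_pos.2 hts), one_mul]
    gcongr
    exact powKernel_anti hγ₀ hγ₁ (sub_pos.2 hts) (by linarith)

/-- E_{γ,1}(-t^γ) = 1 - ∫₀ᵗ z with z ≥ 0. -/
lemma mlKernel_one_anti {γ s t : ℝ} (hγ₀ : 0 < γ) (hγ₁ : γ < 1) (hs : 0 < s) (hst : s ≤ t) :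
    mlKernel γ 1 t ≤ mlKernel γ 1 s := by
  have h (t : ℝ) := integral_powKernel_mul_mlKernel hγ₀ one_pos hγ₀ t
  have h1 : mlKernel γ (1 + γ) s ≤ mlKernel γ (1 + γ) t := by
    rw [← h s, ← h t]
    refine integral_mono (integrable_powKernel_mul_mlKernel hγ₀ one_pos hγ₀ s)
      (integrable_powKernel_mul_mlKernel hγ₀ one_pos hγ₀ t) fun r => ?_
    refine mul_le_mul_of_nonneg_right ?_ (mlKernel_nonneg hγ₀ hγ₁ r)
    rcases le_or_gt s r with hr | hr
    · rw [powKernel_of_nonpos (sub_nonpos.2 hr)]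
      exact powKernel_nonneg one_pos _
    · rw [powKernel_one_of_pos (sub_pos.2 hr), powKernel_one_of_pos (by linarith)]
  rw [add_comm, mlKernel_add_one hγ₀ hs, mlKernel_add_one hγ₀ (hs.trans_le hst)] at h1
  linarith

/-- 1 - E_{γ,1}(-t^γ) is the fractional integral of order γ of the decreasing function
E_{γ,1}(-s^γ), which on (0,t) is at least its final value. It yields the upper bound. -/
lemma powKernel_mul_mlKernel_one_le {γ t : ℝ} (hγ₀ : 0 < γ) (hγ₁ : γ < 1) (ht : 0 < t) :
    powKernel (γ + 1) t * mlKernel γ 1 t ≤ 1 - mlKernel γ 1 t := by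
  rw [← mlKernel_add_one hγ₀ ht, ← integral_powKernel_mul_mlKernel hγ₀ hγ₀ one_pos,
    ← integral_powKernel_mul hγ₀ one_pos, ← integral_mul_const]
  refine integral_mono ((integrable_powKernel_mul hγ₀ one_pos t).mul_const _)
    (integrable_powKernel_mul_mlKernel hγ₀ hγ₀ one_pos t) fun s => ?_
  rcases le_or_gt s 0 with hs | hs
  · simp [mlKernel_of_nonpos hs, powKernel_of_nonpos hs]
  rcases le_or_gt t s with hts | hts
  · simp [powKernel_of_nonpos (sub_nonpos.2 hts)]
  · simp only [powKernel_one_of_pos hs, mul_one]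
    exact mul_le_mul_of_nonneg_left (mlKernel_one_anti hγ₀ hγ₁ hs hts.le) (powKernel_nonneg hγ₀ _)

lemma mittagLeffler_eq_two (γ z : ℝ) : mittagLeffler γ z = mittagLefflerTwo γ 1 z := rfl

lemma mlKernel_one_rpow {γ x : ℝ} (hγ : 0 < γ) (hx : 0 < x) :
    mlKernel γ 1 (x ^ (1 / γ)) = mittagLeffler γ (-x) := by
  have hp : (x ^ (1 / γ)) ^ γ = x := by
    rw [← Real.rpow_mul hx.le, one_div_mul_cancel hγ.ne', Real.rpow_one]
  rw [mlKernel_of_pos (by positivity), hp, sub_self, Real.rpow_zero, one_mul, mittagLeffler_eq_two]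

/-- Two-sided bound for the Mittag-Leffler function on the negative half-line. -/
theorem exists_mittagLeffler_bounds {γ : ℝ} (hγ₀ : 0 < γ) (hγ₁ : γ < 1) :
    ∃ c₁ c₂ : ℝ, 0 < c₁ ∧ 0 < c₂ ∧ ∀ x, 0 ≤ x →
      c₁ / (1 + x) ≤ mittagLeffler γ (-x) ∧ mittagLeffler γ (-x) ≤ c₂ / (1 + x) := by
  set G₁ := Real.Gamma (1 - γ) with hG₁
  set G₂ := Real.Gamma (γ + 1) with hG₂
  have h₁ : 0 < G₁ := Real.Gamma_pos_of_pos (by linarith)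
  have h₂ : 0 < G₂ := Real.Gamma_pos_of_pos (by linarith)
  refine ⟨1 / (1 + G₁), 1 + G₂, by positivity, by positivity, fun x hx => ?_⟩
  rcases hx.eq_or_lt with rfl | hx
  · simp only [neg_zero, add_zero, div_one, mittagLeffler_eq_two, mittagLefflerTwo_zero,
      Real.Gamma_one, inv_one]
    refine ⟨?_, by linarith⟩
    rw [div_le_one (by positivity)]
    linarith
  have ht : 0 < x ^ (1 / γ) := by positivity
  have hp : (x ^ (1 / γ)) ^ γ = x := by
    rw [← Real.rpow_mul hx.le, one_div_mul_cancel hγ₀.ne', Real.rpow_one]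
  have hA := powKernel_mul_one_sub_le hγ₀ hγ₁ ht
  have hB := powKernel_mul_mlKernel_one_le hγ₀ hγ₁ ht
  rw [mlKernel_one_rpow hγ₀ hx, powKernel_of_pos ht] at hA hB
  rw [show 1 - γ - 1 = -γ by ring, Real.rpow_neg ht.le, hp, ← hG₁] at hA
  rw [add_sub_cancel_right, hp, ← hG₂] at hB
  set e := mittagLeffler γ (-x)
  have hA' : 1 ≤ (1 + G₁ * x) * e := by
    have : x⁻¹ / G₁ * (1 - e) * (G₁ * x) ≤ e * (G₁ * x) := by gcongr
    have h3 : x⁻¹ / G₁ * (1 - e) * (G₁ * x) = 1 - e := by field_simp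
    linarith
  have he : 0 < e := by
    by_contra! h
    have : (1 + G₁ * x) * e ≤ 0 := mul_nonpos_of_nonneg_of_nonpos (by positivity) h
    linarith
  constructor
  · rw [div_div, div_le_iff₀ (by positivity)]
    nlinarith [mul_pos h₁ he, mul_pos hx he]
  · rw [le_div_iff₀ (by positivity)]
    have h3 : e * G₂ + x * e ≤ G₂ := by
      have : x / G₂ * e * G₂ ≤ (1 - e) * G₂ := by gcongr
      have h4 : x / G₂ * e * G₂ = x * e := by field_simp
      linarith
    have h4 : e ≤ 1 := by
      have : 0 ≤ x / G₂ * e := by positivity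
      linarith
    linarith [mul_pos he h₂]

/-! ### Hierarchies of Caputo equations -/

lemma norm_indicator_le_powKernel {F : Type*} [NormedAddCommGroup F] {T C R : ℝ} {y : ℕ → ℝ → F}
    (hC : 0 ≤ C) (hR : 0 ≤ R)
    (hb : ∀ k, ∀ t ∈ Icc 0 T, ‖y k t‖ ≤ C * R ^ k) (k : ℕ) (s : ℝ) :
    ‖(Ioo 0 T).indicator (y k) s‖ ≤ C * R ^ k * powKernel 1 s := by
  by_cases hs : s ∈ Ioo 0 T
  · rw [indicator_of_mem hs, powKernel_one_of_pos hs.1, mul_one]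
    exact hb k s (Ioo_subset_Icc_self hs)
  · rw [indicator_of_notMem hs, norm_zero]
    have := powKernel_nonneg one_pos s
    positivity

lemma aestronglyMeasurable_indicator_Ioo {F : Type*} [NormedAddCommGroup F] {T : ℝ}
    {f : ℝ → F} (hc : ContinuousOn f (Icc 0 T)) :
    AEStronglyMeasurable ((Ioo 0 T).indicator f) :=
  (aestronglyMeasurable_indicator_iff measurableSet_Ioo).2
    ((hc.mono Ioo_subset_Icc_self).aestronglyMeasurable measurableSet_Ioo)

section AbstractEquation

variable {F : Type*} [NormedAddCommGroup F] [NormedSpace ℝ F]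

lemma intervalIntegrable_of_rpow_smul {γ t : ℝ} {f : ℝ → F} (hγ : 0 < γ) (ht : 0 < t)
    (hf : IntervalIntegrable (fun s => (t - s) ^ (-γ) • f s) volume 0 t) :
    IntervalIntegrable f volume 0 t := by
  have hc : ContinuousOn (fun s : ℝ => (t - s) ^ γ) (uIcc 0 t) := by
    refine Continuous.continuousOn ?_
    exact (continuous_const.sub continuous_id).rpow_const fun _ => Or.inr hγ.le
  have h := hf.continuousOn_smul hc
  rw [intervalIntegrable_iff_integrableOn_Ioo_of_le ht.le] at h ⊢
  refine h.congr_fun (fun s hs => ?_) measurableSet_Ioo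
  have hts : 0 < t - s := sub_pos.2 hs.2
  simp only [smul_smul, ← Real.rpow_add hts, add_neg_cancel, Real.rpow_zero, one_smul]

lemma fracInt_indicator_deriv {γ t s : ℝ} {y : ℝ → F} (hs : 0 < s) (hst : s < t) :
    fracInt (1 - γ) ((Ioo 0 t).indicator (deriv y)) s = caputoDeriv γ y s := by
  rw [caputoDeriv, intervalIntegral.integral_of_le hs.le, integral_Ioc_eq_integral_Ioo,
    ← integral_indicator measurableSet_Ioo, fracInt, ← integral_smul]
  congr 1 with r
  by_cases hr : r ∈ Ioo 0 s
  · have hr' : r ∈ Ioo 0 t := ⟨hr.1, hr.2.trans hst⟩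
    rw [indicator_of_mem hr, indicator_of_mem hr',
      powKernel_of_pos (sub_pos.2 hr.2), smul_smul, show 1 - γ - 1 = -γ by ring]
    congr 1
    ring
  · rw [indicator_of_notMem hr, smul_zero]
    rcases le_or_gt r 0 with h | h
    · rw [indicator_of_notMem (fun h' => by linarith [h'.1]), smul_zero]
    · rw [powKernel_of_nonpos, zero_smul]
      by_contra! h'
      exact hr ⟨h, by linarith⟩

variable [CompleteSpace F]

/-- Fractional integration inverts the Caputo derivative. -/
lemma eq_add_fracInt_caputoDeriv {γ T : ℝ} (hγ₀ : 0 < γ) (hγ₁ : γ < 1) {y : ℝ → F}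
    (hc : ContinuousOn y (Icc 0 T)) (hd : ∀ t ∈ Ioo 0 T, DifferentiableAt ℝ y t)
    (hi : ∀ t ∈ Ioo 0 T, IntervalIntegrable (fun s => (t - s) ^ (-γ) • deriv y s) volume 0 t)
    {t : ℝ} (ht : t ∈ Ioo 0 T) :
    y t = y 0 + fracInt γ ((Ioo 0 T).indicator (caputoDeriv γ y)) t := by
  have hint := intervalIntegrable_of_rpow_smul hγ₀ ht.1 (hi t ht)
  set f := (Ioo 0 t).indicator (deriv y) with hf
  have hfint : Integrable f := (integrable_indicator_iff measurableSet_Ioo).2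
    ((intervalIntegrable_iff_integrableOn_Ioo_of_le ht.1.le).1 hint)
  have hone : (fun r => powKernel 1 (t - r) • f r) = f := by
    ext r
    by_cases hr : r ∈ Ioo 0 t
    · rw [powKernel_one_of_pos (sub_pos.2 hr.2), one_smul]
    · rw [hf, indicator_of_notMem hr, smul_zero]
  have hftc : fracInt 1 f t = y t - y 0 := by
    rw [← intervalIntegral.integral_eq_sub_of_hasDerivAt_of_le ht.1.le
      (hc.mono (Icc_subset_Icc_right ht.2.le))
      (fun s hs => (hd s ⟨hs.1, hs.2.trans ht.2⟩).hasDerivAt) hint, fracInt, hone, hf,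
      integral_indicator measurableSet_Ioo, intervalIntegral.integral_of_le ht.1.le,
      integral_Ioc_eq_integral_Ioo]
  -- The Caputo derivative is I^(1-γ) y', so I^γ turns it into I^1 y' = y(t) - y(0).
  have hsg : γ + (1 - γ) = 1 := by ring
  have h := fracInt_fracInt (t := t) hγ₀ (by linarith : 0 < 1 - γ) hfint.aestronglyMeasurable
    (by rw [hsg, hone]; exact hfint)
  rw [hsg, hftc] at h
  have h2 : fracInt γ (fracInt (1 - γ) f) t =
      fracInt γ ((Ioo 0 T).indicator (caputoDeriv γ y)) t := by
    rw [fracInt, fracInt]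
    congr 1 with s
    rcases le_or_gt t s with hs | hs
    · simp [powKernel_of_nonpos (sub_nonpos.2 hs)]
    congr 1
    rcases le_or_gt s 0 with hs' | hs'
    · rw [indicator_of_notMem (fun h' => by linarith [h'.1]), fracInt, integral_eq_zero_of_ae]
      filter_upwards with r
      rcases le_or_gt r 0 with hr | hr
      · rw [hf, indicator_of_notMem (fun h' => by linarith [h'.1]), smul_zero, Pi.zero_apply]
      · rw [powKernel_of_nonpos (by linarith), zero_smul, Pi.zero_apply]
    · have hsT : s ∈ Ioo 0 T := ⟨hs', hs.trans ht.2⟩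
      rw [indicator_of_mem hsT, fracInt_indicator_deriv hs' hs]
  rw [← h2, h]
  abel

section Iteration

variable {γ T C R : ℝ} {y : ℕ → ℝ → F}

/-- Apply I^a to y_k = y_k(0) - I^γ y_{k+1} and use the semigroup law; this is the inductive step of
the expansion. -/
lemma fracInt_step (hγ : 0 < γ) (hC : 0 ≤ C) (hR : 0 ≤ R)
    (hc : ∀ k, ContinuousOn (y k) (Icc 0 T))
    (hb : ∀ k, ∀ t ∈ Icc 0 T, ‖y k t‖ ≤ C * R ^ k)
    (he : ∀ k, ∀ t ∈ Ioo 0 T, y k t = y k 0 - fracInt γ ((Ioo 0 T).indicator (y (k + 1))) t)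
    {a : ℝ} (ha : 0 < a) (k : ℕ) {t : ℝ} (ht : t ∈ Ioo 0 T) :
    fracInt a ((Ioo 0 T).indicator (y k)) t =
      powKernel (a + 1) t • y k 0 - fracInt (a + γ) ((Ioo 0 T).indicator (y (k + 1))) t := by
  have hm := aestronglyMeasurable_indicator_Ioo (hc (k + 1))
  have hi := integrable_powKernel_smul_of_bounded (add_pos ha hγ) t hm
    (norm_indicator_le_powKernel hC hR hb (k + 1))
  have hi1 : Integrable fun s => powKernel a (t - s) • powKernel 1 s • y k 0 := by
    simp_rw [smul_smul]
    exact (integrable_powKernel_mul ha one_pos t).smul_const _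
  rw [← fracInt_fracInt ha hγ hm hi, ← fracInt_powKernel_one_smul ha, fracInt, fracInt,
    fracInt, ← integral_sub hi1 (integrable_powKernel_smul_fracInt ha hγ hm hi)]
  congr 1 with s
  rcases le_or_gt t s with hs | hs
  · simp [powKernel_of_nonpos (sub_nonpos.2 hs)]
  rw [← smul_sub]
  congr 1
  rcases le_or_gt s 0 with hs' | hs'
  · rw [indicator_of_notMem (fun h' => not_lt.2 hs' h'.1), powKernel_of_nonpos hs', zero_smul,
      zero_sub, eq_comm, neg_eq_zero, fracInt, integral_eq_zero_of_ae]
    filter_upwards with r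
    rcases le_or_gt r 0 with hr | hr
    · rw [indicator_of_notMem (fun h' => not_lt.2 hr h'.1), smul_zero, Pi.zero_apply]
    · rw [powKernel_of_nonpos (by linarith), zero_smul, Pi.zero_apply]
  · have hsT : s ∈ Ioo 0 T := ⟨hs', hs.trans ht.2⟩
    rw [indicator_of_mem hsT, powKernel_one_of_pos hs', one_smul, he k s hsT]

lemma eq_sum_add_fracInt (hγ : 0 < γ) (hC : 0 ≤ C) (hR : 0 ≤ R)
    (hc : ∀ k, ContinuousOn (y k) (Icc 0 T))
    (hb : ∀ k, ∀ t ∈ Icc 0 T, ‖y k t‖ ≤ C * R ^ k)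
    (he : ∀ k, ∀ t ∈ Ioo 0 T, y k t = y k 0 - fracInt γ ((Ioo 0 T).indicator (y (k + 1))) t)
    (N : ℕ) {t : ℝ} (ht : t ∈ Ioo 0 T) :
    y 0 t = ∑ k ∈ Finset.range (N + 1), ((-1) ^ k * powKernel (γ * k + 1) t) • y k 0 +
      (-1 : ℝ) ^ (N + 1) •
        fracInt (γ * ((N + 1 : ℕ) : ℝ)) ((Ioo 0 T).indicator (y (N + 1))) t := by
  induction N with
  | zero =>
    rw [he 0 t ht]
    simp [powKernel_one_of_pos ht.1, sub_eq_add_neg]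
  | succ N ih =>
    rw [ih, Finset.sum_range_succ _ (N + 1), fracInt_step hγ hC hR hc hb he (by positivity) _ ht,
      show γ * ((N + 1 : ℕ) : ℝ) + γ = γ * ((N + 1 + 1 : ℕ) : ℝ) by push_cast; ring, smul_sub,
      pow_succ (-1 : ℝ) (N + 1), smul_smul, mul_neg_one, neg_smul]
    abel

lemma hasSum_of_fracInt_eq (hγ : 0 < γ) (hC : 0 ≤ C) (hR : 0 ≤ R)
    (hc : ∀ k, ContinuousOn (y k) (Icc 0 T))
    (hb : ∀ k, ∀ t ∈ Icc 0 T, ‖y k t‖ ≤ C * R ^ k)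
    (he : ∀ k, ∀ t ∈ Ioo 0 T, y k t = y k 0 - fracInt γ ((Ioo 0 T).indicator (y (k + 1))) t)
    {t : ℝ} (ht : t ∈ Ioo 0 T) :
    HasSum (fun k : ℕ => ((-1) ^ k * powKernel (γ * k + 1) t) • y k 0) (y 0 t) := by
  have h0 : (0 : ℝ) ∈ Icc 0 T := ⟨le_rfl, (ht.1.trans ht.2).le⟩
  have hk (k : ℕ) : 0 < γ * k + 1 := by positivity
  have hsum0 : Summable fun k : ℕ => C * R ^ k * powKernel (γ * k + 1) t := by
    refine ((summable_pow_div_Gamma hγ 1 (t ^ γ * R)).mul_left C).congr fun k => ?_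
    rw [powKernel_mul_add ht.1, sub_self, Real.rpow_zero, mul_pow]
    ring
  have hsum : Summable fun k : ℕ => ((-1) ^ k * powKernel (γ * k + 1) t) • y k 0 := by
    refine Summable.of_norm_bounded hsum0 fun k => ?_
    rw [norm_smul, norm_mul, norm_pow, norm_neg, norm_one, one_pow, one_mul,
      Real.norm_of_nonneg (powKernel_nonneg (hk k) _), mul_comm]
    exact mul_le_mul_of_nonneg_right (hb k 0 h0) (powKernel_nonneg (hk k) _)
  -- The remainder is bounded by C R^(N+1) t^(γ(N+1))/Γ(γ(N+1)+1), the general term of a convergent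
  -- series.
  have hrem : Tendsto (fun N : ℕ => (-1 : ℝ) ^ (N + 1) •
      fracInt (γ * ((N + 1 : ℕ) : ℝ)) ((Ioo 0 T).indicator (y (N + 1))) t) atTop (𝓝 0) := by
    refine squeeze_zero_norm (fun N => ?_)
      ((tendsto_add_atTop_iff_nat 1).2 hsum0.tendsto_atTop_zero)
    rw [norm_smul, norm_pow, norm_neg, norm_one, one_pow, one_mul]
    exact norm_fracInt_le_of_bounded (by positivity) t
      (norm_indicator_le_powKernel hC hR hb (N + 1))
  have hlim := ((tendsto_add_atTop_iff_nat 1).2 hsum.hasSum.tendsto_sum_nat).add hrem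
  simp_rw [← eq_sum_add_fracInt hγ hC hR hc hb he _ ht, add_zero] at hlim
  rw [tendsto_nhds_unique tendsto_const_nhds hlim]
  exact hsum.hasSum

end Iteration

/-- A bounded hierarchy of Caputo equations `D^γ y_k = -y_{k+1}` is solved by the
Mittag-Leffler series. -/
theorem eq_tsum_of_caputoDeriv_eq {γ T C R : ℝ} {y : ℕ → ℝ → F} (hγ₀ : 0 < γ) (hγ₁ : γ < 1)
    (hT : 0 < T) (hC : 0 ≤ C) (hR : 0 ≤ R)
    (hc : ∀ k, ContinuousOn (y k) (Icc 0 T))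
    (hd : ∀ k, ∀ t ∈ Ioo 0 T, DifferentiableAt ℝ (y k) t)
    (hi : ∀ k, ∀ t ∈ Ioo 0 T,
      IntervalIntegrable (fun s => (t - s) ^ (-γ) • deriv (y k) s) volume 0 t)
    (hb : ∀ k, ∀ t ∈ Icc 0 T, ‖y k t‖ ≤ C * R ^ k)
    (he : ∀ k, ∀ t ∈ Ioo 0 T, caputoDeriv γ (y k) t = -y (k + 1) t) {t : ℝ} (ht : t ∈ Icc 0 T) :
    y 0 t = ∑' k : ℕ, ((-t ^ γ) ^ k / Real.Gamma (γ * k + 1)) • y k 0 := by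
  have he' : ∀ k, ∀ t ∈ Ioo 0 T,
      y k t = y k 0 - fracInt γ ((Ioo 0 T).indicator (y (k + 1))) t := by
    intro k t ht
    rw [eq_add_fracInt_caputoDeriv hγ₀ hγ₁ (hc k) (hd k) (hi k) ht, sub_eq_add_neg]
    congr 1
    rw [fracInt, fracInt, ← integral_neg]
    congr 1 with s
    by_cases hs : s ∈ Ioo 0 T
    · simp [hs, he k s hs]
    · simp [hs]
  have h0 : (0 : ℝ) ∈ Icc 0 T := ⟨le_rfl, hT.le⟩
  have hcont : ContinuousOn
      (fun t : ℝ => ∑' k : ℕ, ((-t ^ γ) ^ k / Real.Gamma (γ * k + 1)) • y k 0) (Icc 0 T) := by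
    refine continuousOn_tsum (u := fun k : ℕ => C * ((T ^ γ * R) ^ k / Real.Gamma (γ * k + 1)))
      (fun k => ?_) ((summable_pow_div_Gamma hγ₀ 1 (T ^ γ * R)).mul_left C) fun k s hs => ?_
    · have : Continuous fun t : ℝ => t ^ γ := Real.continuous_rpow_const hγ₀.le
      fun_prop
    · have hG : 0 < Real.Gamma (γ * k + 1) := Real.Gamma_pos_of_pos (by positivity)
      have hs0 : 0 ≤ s := hs.1
      rw [norm_smul, norm_div, norm_pow, norm_neg, Real.norm_of_nonneg hG.le,
        Real.norm_of_nonneg (by positivity)]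
      calc _ ≤ (T ^ γ) ^ k / Real.Gamma (γ * k + 1) * (C * R ^ k) := by
            gcongr
            · exact hs.2
            · exact hb k 0 h0
        _ = _ := by rw [mul_pow]; ring
  have heq : EqOn (y 0)
      (fun t : ℝ => ∑' k : ℕ, ((-t ^ γ) ^ k / Real.Gamma (γ * k + 1)) • y k 0) (Ioo 0 T) := by
    intro s hs
    rw [← (hasSum_of_fracInt_eq hγ₀ hC hR hc hb he' hs).tsum_eq]
    congr 1 with k
    rw [powKernel_mul_add hs.1, sub_self, Real.rpow_zero, neg_pow (s ^ γ)]
    congr 1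
    ring
  -- The equation holds only inside (0,T); continuity of both sides gives the endpoints, and t = T
  -- is needed for the final datum.
  exact heq.of_subset_closure (hc 0) hcont Ioo_subset_Icc_self
    (by rw [closure_Ioo hT.ne]) ht

end AbstractEquation

/-! ### Fourier representation of weak solutions -/

variable {n : ℕ}

-- Transform the distributional identity, then test against smooth compactly supported functions:
-- both sides are locally integrable, so they agree almost everywhere.
open TemperedDistribution in
lemma fourier_ae_eq_of_eq_laplacian {f g : L2 n}
    (h : (f : 𝓢'(EuclideanSpace ℝ (Fin n), ℂ)) = Δ (g : 𝓢'(EuclideanSpace ℝ (Fin n), ℂ))) :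
    ∀ᵐ η, (𝓕 f : L2 n) η = (-‖(2 * Real.pi) • η‖ ^ 2 : ℝ) • (𝓕 g : L2 n) η := by
  have hF : 𝓕 (f : 𝓢'(EuclideanSpace ℝ (Fin n), ℂ)) = ((-(2 * Real.pi) ^ 2 : ℝ) : ℂ) •
      smulLeftCLM ℂ (fun x : EuclideanSpace ℝ (Fin n) => Complex.ofReal (‖x‖ ^ 2))
        (𝓕 (g : 𝓢'(EuclideanSpace ℝ (Fin n), ℂ))) := by
    rw [h, laplacian_eq_fourierMultiplierCLM, fourierMultiplierCLM_apply, ← Complex.coe_smul,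
      FourierTransform.fourier_smul, FourierTransform.fourier_fourierInv_eq]
  rw [Lp.fourier_toTemperedDistribution_eq, Lp.fourier_toTemperedDistribution_eq] at hF
  have hloc (f : L2 n) : LocallyIntegrable f volume := (Lp.memLp f).locallyIntegrable (by norm_num)
  have hcont : Continuous fun η : EuclideanSpace ℝ (Fin n) => -‖(2 * Real.pi) • η‖ ^ 2 := by fun_prop
  refine ae_eq_of_integral_contDiff_smul_eq (hloc _) ?_ fun φ hφ hφc => ?_
  · rw [← locallyIntegrableOn_univ]
    exact ((hloc _).locallyIntegrableOn univ).continuousOn_smul isOpen_univ.isLocallyClosed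
      hcont.continuousOn
  have hg₁ : HasCompactSupport (Complex.ofRealCLM ∘ φ) := hφc.comp_left rfl
  have hg₂ : ContDiff ℝ (⊤ : ℕ∞) (Complex.ofRealCLM ∘ φ) := Complex.ofRealCLM.contDiff.comp hφ
  have key := DFunLike.congr_fun hF (hg₁.toSchwartzMap hg₂)
  rw [Lp.toTemperedDistribution_apply, _root_.smul_apply, smulLeftCLM_apply_apply,
    Lp.toTemperedDistribution_apply, ← integral_smul] at key
  refine Eq.trans (integral_congr_ae ?_) (key.trans (integral_congr_ae ?_))
  · filter_upwards with x
    simp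
  · filter_upwards with x
    rw [SchwartzMap.smulLeftCLM_apply_apply (by fun_prop)]
    simp [norm_smul, mul_pow]
    ring

/-- The truncated power `1_B(η) |2πη|^(2k)`. -/
noncomputable def spectralWeight (B : Set (EuclideanSpace ℝ (Fin n))) (k : ℕ)
    (η : EuclideanSpace ℝ (Fin n)) : ℂ :=
  B.indicator (fun η => (((‖(2 * Real.pi) • η‖ ^ 2) ^ k : ℝ) : ℂ)) η

lemma memLp_spectralWeight {B : Set (EuclideanSpace ℝ (Fin n))} (hB : MeasurableSet B) {R : ℝ}
    (hR : ∀ η ∈ B, ‖(2 * Real.pi) • η‖ ^ 2 ≤ R) (hBfin : volume B < ∞) (k : ℕ) :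
    MemLp (spectralWeight B k) 2 volume := by
  refine MemLp.of_le_mul (c := R ^ k) (g := B.indicator fun _ => (1 : ℂ))
    (memLp_indicator_const 2 hB 1 (Or.inr hBfin.ne)) ?_ ?_
  · refine Measurable.aestronglyMeasurable ?_
    unfold spectralWeight
    refine Measurable.indicator (Continuous.measurable ?_) hB
    fun_prop
  · filter_upwards with η
    by_cases hη : η ∈ B
    · simp only [spectralWeight, indicator_of_mem hη, Complex.norm_real, norm_one, mul_one]
      rw [Real.norm_of_nonneg (by positivity)]
      gcongr
      exact hR η hη
    · simp [spectralWeight, hη]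

/-- The functional `f ↦ ∫_B |2πη|^(2k) 𝓕f(η) dη`. -/
noncomputable def spectralFunctional {B : Set (EuclideanSpace ℝ (Fin n))} {k : ℕ}
    (h : MemLp (spectralWeight B k) 2 volume) : L2 n →L[ℂ] ℂ :=
  (innerSL ℂ (h.toLp _ : L2 n)).comp
    (Lp.fourierTransformₗᵢ (EuclideanSpace ℝ (Fin n)) ℂ).toContinuousLinearEquiv.toContinuousLinearMap

lemma spectralFunctional_apply {B : Set (EuclideanSpace ℝ (Fin n))} (hB : MeasurableSet B) {k : ℕ}
    (h : MemLp (spectralWeight B k) 2 volume) (f : L2 n) :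
    spectralFunctional h f = ∫ η in B, ((‖(2 * Real.pi) • η‖ ^ 2) ^ k : ℝ) • (𝓕 f : L2 n) η := by
  change inner ℂ (h.toLp _ : L2 n) (𝓕 f : L2 n) = _
  rw [L2.inner_def, ← integral_indicator hB]
  refine integral_congr_ae ?_
  filter_upwards [h.coeFn_toLp] with η hη
  rw [hη]
  by_cases hB' : η ∈ B
  · simp [spectralWeight, hB', RCLike.inner_apply, mul_comm]
  · simp [spectralWeight, hB']

lemma norm_spectralFunctional_le {B : Set (EuclideanSpace ℝ (Fin n))} {R : ℝ}
    (h : ∀ k, MemLp (spectralWeight B k) 2 volume)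
    (hR : ∀ η ∈ B, ‖(2 * Real.pi) • η‖ ^ 2 ≤ R) (k : ℕ) (f : L2 n) :
    ‖spectralFunctional (h k) f‖ ≤ ‖(h 0).toLp _‖ * ‖f‖ * R ^ k := by
  have h1 : ‖(h k).toLp _‖ ≤ R ^ k * ‖(h 0).toLp _‖ := by
    refine Lp.norm_le_mul_norm_of_ae_le_mul ?_
    filter_upwards [(h k).coeFn_toLp, (h 0).coeFn_toLp] with η h1 h2
    rw [h1, h2]
    by_cases hη : η ∈ B
    · simp only [spectralWeight, indicator_of_mem hη, Complex.norm_real, pow_zero, norm_one,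
        mul_one]
      rw [Real.norm_of_nonneg (by positivity)]
      gcongr
      exact hR η hη
    · simp [spectralWeight, hη]
  calc ‖spectralFunctional (h k) f‖ ≤ ‖(h k).toLp _‖ * ‖(𝓕 f : L2 n)‖ :=
        norm_inner_le_norm (𝕜 := ℂ) ((h k).toLp _ : L2 n) (𝓕 f : L2 n)
    _ ≤ R ^ k * ‖(h 0).toLp _‖ * ‖f‖ := by
        rw [Lp.norm_fourier_eq]
        gcongr
    _ = _ := by ring

lemma caputoDeriv_clm_comp {F G : Type*} [NormedAddCommGroup F] [NormedSpace ℝ F]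
    [NormedAddCommGroup G] [NormedSpace ℝ G] [CompleteSpace F] [CompleteSpace G] {γ T : ℝ}
    (L : F →L[ℝ] G) {u : ℝ → F} (hd : ∀ t ∈ Ioo 0 T, DifferentiableAt ℝ u t)
    (hi : ∀ t ∈ Ioo 0 T, IntervalIntegrable (fun s => (t - s) ^ (-γ) • deriv u s) volume 0 t)
    {t : ℝ} (ht : t ∈ Ioo 0 T) :
    IntervalIntegrable (fun s => (t - s) ^ (-γ) • deriv (fun s => L (u s)) s) volume 0 t ∧
      caputoDeriv γ (fun s => L (u s)) t = L (caputoDeriv γ u t) := by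
  have hderiv : EqOn (fun s => L ((t - s) ^ (-γ) • deriv u s))
      (fun s => (t - s) ^ (-γ) • deriv (fun s => L (u s)) s) (Ioo 0 t) := by
    intro s hs
    have h1 : HasDerivAt (fun s => L (u s)) (L (deriv u s)) s :=
      L.hasFDerivAt.comp_hasDerivAt s (hd s ⟨hs.1, hs.2.trans ht.2⟩).hasDerivAt
    simp only [h1.deriv, map_smul]
  constructor
  · have h1 := (intervalIntegrable_iff_integrableOn_Ioo_of_le ht.1.le).1 (hi t ht)
    rw [intervalIntegrable_iff_integrableOn_Ioo_of_le ht.1.le]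
    exact IntegrableOn.congr_fun (L.integrable_comp h1) hderiv measurableSet_Ioo
  · rw [caputoDeriv, caputoDeriv, map_smul, ← L.intervalIntegral_comp_comm (hi t ht)]
    congr 1
    rw [intervalIntegral.integral_of_le ht.1.le, intervalIntegral.integral_of_le ht.1.le,
      integral_Ioc_eq_integral_Ioo, integral_Ioc_eq_integral_Ioo]
    exact (setIntegral_congr_fun measurableSet_Ioo hderiv).symm

/-- The moments y_k(t) = ∫_B |2πη|^(2k) 𝓕(u t) satisfy D^γ y_k = -y_{k+1} and |y_k| ≤ C R^k because
B is bounded in frequency. `eq_tsum_of_caputoDeriv_eq` expands y_0(t) in the y_k(0), and exchanging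
sum and integral reassembles the Mittag-Leffler function under the integral. -/
lemma IsWeakSolution.setIntegral_fourier {γ T : ℝ} (hγ₀ : 0 < γ) (hγ₁ : γ < 1) (hT : 0 < T)
    {u : ℝ → L2 n} {g : L2 n} (hu : IsWeakSolution γ T u g) {t : ℝ} (ht : t ∈ Icc 0 T)
    {B : Set (EuclideanSpace ℝ (Fin n))} (hB : MeasurableSet B) (hBfin : volume B < ∞) {R : ℝ}
    (hR0 : 0 ≤ R) (hR : ∀ η ∈ B, ‖(2 * Real.pi) • η‖ ^ 2 ≤ R) :
    ∫ η in B, (𝓕 (u t) : L2 n) η =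
      ∫ η in B, mittagLeffler γ (-‖(2 * Real.pi) • η‖ ^ 2 * t ^ γ) • (𝓕 (u 0) : L2 n) η := by
  have hmem := memLp_spectralWeight hB hR hBfin
  set L : ℕ → L2 n →L[ℝ] ℂ := fun k => (spectralFunctional (hmem k)).restrictScalars ℝ with hL
  have hLapply (k : ℕ) (f : L2 n) :
      L k f = ∫ η in B, ((‖(2 * Real.pi) • η‖ ^ 2) ^ k : ℝ) • (𝓕 f : L2 n) η :=
    spectralFunctional_apply hB (hmem k) f
  obtain ⟨M, hM⟩ := isCompact_Icc.exists_bound_of_continuousOn hu.continuousOn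
  have hM0 : 0 ≤ M := (norm_nonneg _).trans (hM t ht)
  have hcomp (k : ℕ) {s : ℝ} (hs : s ∈ Ioo 0 T) :=
    caputoDeriv_clm_comp (L k) hu.differentiableAt hu.intervalIntegrable hs
  have main := eq_tsum_of_caputoDeriv_eq (y := fun k s => L k (u s)) (R := R)
    (C := ‖(hmem 0).toLp _‖ * M) hγ₀ hγ₁ hT (by positivity) hR0
    (fun k => (L k).continuous.comp_continuousOn hu.continuousOn)
    (fun k s hs => ((L k).differentiableAt.comp s (hu.differentiableAt s hs)))
    (fun k s hs => (hcomp k hs).1)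
    (fun k s hs => (norm_spectralFunctional_le hmem hR k (u s)).trans (by gcongr; exact hM s hs))
    (fun k s hs => by
      rw [(hcomp k hs).2, hLapply, hLapply, ← integral_neg]
      refine integral_congr_ae (ae_restrict_of_ae ?_)
      filter_upwards [fourier_ae_eq_of_eq_laplacian (hu.equation s hs)] with η hη
      rw [hη, smul_smul, ← neg_smul]
      congr 1
      ring) ht
  have hint : IntegrableOn (𝓕 (u 0) : L2 n) B := by
    have : Fact (volume B < ∞) := ⟨hBfin⟩
    exact ((Lp.memLp (𝓕 (u 0) : L2 n)).restrict B).integrable (by norm_num)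
  have h0 : L 0 (u t) = ∫ η in B, (𝓕 (u t) : L2 n) η := by
    simp [hLapply]
  rw [← h0, main]
  set c : ℕ → ℝ := fun k => (-t ^ γ) ^ k / Real.Gamma (γ * k + 1) with hc
  have hFint (k : ℕ) : Integrable (fun η => (c k * (‖(2 * Real.pi) • η‖ ^ 2) ^ k) •
      (𝓕 (u 0) : L2 n) η) (volume.restrict B) := by
    refine (hint.norm.const_mul (|c k| * R ^ k)).mono' ?_ ?_
    · have : Continuous fun η : EuclideanSpace ℝ (Fin n) =>
          c k * (‖(2 * Real.pi) • η‖ ^ 2) ^ k := by fun_prop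
      exact this.aestronglyMeasurable.smul hint.aestronglyMeasurable
    · filter_upwards [ae_restrict_mem hB] with η hη
      rw [norm_smul, norm_mul, Real.norm_eq_abs, Real.norm_of_nonneg (by positivity)]
      have := hR η hη
      gcongr
  have hsum : Summable fun k => ∫ η in B, ‖(c k * (‖(2 * Real.pi) • η‖ ^ 2) ^ k) •
      (𝓕 (u 0) : L2 n) η‖ := by
    refine Summable.of_nonneg_of_le (fun k => integral_nonneg fun _ => norm_nonneg _) (fun k => ?_)
      ((summable_pow_div_Gamma hγ₀ 1 (t ^ γ * R)).mul_right (∫ η in B, ‖(𝓕 (u 0) : L2 n) η‖))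
    rw [← integral_const_mul]
    refine integral_mono_ae (hFint k).norm (hint.norm.const_mul _) ?_
    filter_upwards [ae_restrict_mem hB] with η hη
    have hG : 0 < Real.Gamma (γ * k + 1) := Real.Gamma_pos_of_pos (by positivity)
    have ht0 : 0 ≤ t := ht.1
    have := hR η hη
    rw [norm_smul, norm_mul, hc, norm_div, norm_pow, norm_neg, Real.norm_of_nonneg hG.le,
      Real.norm_of_nonneg (by positivity : 0 ≤ t ^ γ), Real.norm_of_nonneg (by positivity), mul_pow]
    gcongr ?_ * _
    calc _ ≤ (t ^ γ) ^ k / Real.Gamma (γ * k + 1) * R ^ k := by gcongr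
      _ = _ := by ring
  have hswap := (hasSum_integral_of_summable_integral_norm hFint hsum).tsum_eq
  have hterm (k : ℕ) : ∫ η in B, (c k * (‖(2 * Real.pi) • η‖ ^ 2) ^ k) • (𝓕 (u 0) : L2 n) η =
      c k • L k (u 0) := by
    rw [hLapply, ← integral_smul]
    simp_rw [smul_smul]
  simp_rw [hterm] at hswap
  rw [hswap]
  congr 1 with η
  have hml : mittagLeffler γ (-‖(2 * Real.pi) • η‖ ^ 2 * t ^ γ) =
      ∑' k, c k * (‖(2 * Real.pi) • η‖ ^ 2) ^ k := by
    rw [mittagLeffler]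
    congr 1 with k
    rw [hc, show -‖(2 * Real.pi) • η‖ ^ 2 * t ^ γ = -t ^ γ * ‖(2 * Real.pi) • η‖ ^ 2 by ring,
      mul_pow]
    ring
  have hs : Summable fun k => c k * (‖(2 * Real.pi) • η‖ ^ 2) ^ k := by
    refine (summable_pow_div_Gamma hγ₀ 1 (-t ^ γ * ‖(2 * Real.pi) • η‖ ^ 2)).congr fun k => ?_
    rw [hc, mul_pow]
    ring
  rw [hml, hs.tsum_smul_const]

lemma continuous_mittagLeffler {γ : ℝ} (hγ : 0 < γ) : Continuous (mittagLeffler γ) :=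
  (differentiable_mittagLefflerTwo hγ one_pos).continuous

/-- The spatial Fourier transform of a weak solution is governed by the Mittag-Leffler function. -/
theorem IsWeakSolution.fourier_ae_eq {γ T : ℝ} (hγ₀ : 0 < γ) (hγ₁ : γ < 1) (hT : 0 < T)
    {u : ℝ → L2 n} {g : L2 n} (hu : IsWeakSolution γ T u g) {t : ℝ} (ht : t ∈ Icc 0 T) :
    ∀ᵐ η, (𝓕 (u t) : L2 n) η =
      mittagLeffler γ (-‖(2 * Real.pi) • η‖ ^ 2 * t ^ γ) • (𝓕 (u 0) : L2 n) η := by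
  have hball (N : ℕ) : ∀ᵐ η, η ∈ Metric.ball (0 : EuclideanSpace ℝ (Fin n)) N →
      (𝓕 (u t) : L2 n) η =
        mittagLeffler γ (-‖(2 * Real.pi) • η‖ ^ 2 * t ^ γ) • (𝓕 (u 0) : L2 n) η := by
    set B := Metric.ball (0 : EuclideanSpace ℝ (Fin n)) N with hB
    have hBfin : volume B < ∞ := measure_ball_lt_top
    have hfin : Fact (volume B < ∞) := ⟨hBfin⟩
    have hint (f : L2 n) : IntegrableOn f B := ((Lp.memLp f).restrict B).integrable (by norm_num)
    have hcont : Continuous fun η : EuclideanSpace ℝ (Fin n) =>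
        mittagLeffler γ (-‖(2 * Real.pi) • η‖ ^ 2 * t ^ γ) :=
      (continuous_mittagLeffler hγ₀).comp (by fun_prop)
    obtain ⟨C, hC⟩ := (isCompact_closedBall (0 : EuclideanSpace ℝ (Fin n))
      N).exists_bound_of_continuousOn hcont.continuousOn
    rw [← ae_restrict_iff' measurableSet_ball]
    -- Equal integrals over every measurable subset of the ball force equality almost everywhere on
    -- it; countably many balls exhaust the space.
    refine Integrable.ae_eq_of_forall_setIntegral_eq _ _ (hint _) ?_ fun S hS _ => ?_
    · refine ((hint (𝓕 (u 0))).norm.const_mul C).mono'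
        (hcont.aestronglyMeasurable.smul (hint _).aestronglyMeasurable) ?_
      filter_upwards [ae_restrict_mem measurableSet_ball] with η hη
      rw [norm_smul]
      exact mul_le_mul_of_nonneg_right (hC η (Metric.ball_subset_closedBall hη)) (norm_nonneg _)
    · rw [Measure.restrict_restrict hS]
      refine hu.setIntegral_fourier hγ₀ hγ₁ hT ht (hS.inter measurableSet_ball)
        ((measure_mono inter_subset_right).trans_lt hBfin)
        (R := (2 * Real.pi * N) ^ 2) (by positivity) fun η hη => ?_
      have h1 : ‖η‖ ≤ N := (mem_ball_zero_iff.1 hη.2).le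
      rw [norm_smul, Real.norm_of_nonneg (by positivity)]
      gcongr
  filter_upwards [ae_all_iff.2 hball] with η hη
  obtain ⟨N, hN⟩ := exists_nat_gt ‖η‖
  exact hη N (mem_ball_zero_iff.2 hN)

/-! ### Bounds on the symbols -/

/-- For x ≤ 1, 1 - e^(-y) ≤ y and x^s ≤ x^ρ; for x > 1 the left side is below 1. The restriction ρ ≤
s is the origin of p+2-l ≤ s and p-l ≤ s. -/
lemma one_sub_exp_neg_le_rpow {τ s ρ x : ℝ} (hτ : 0 < τ) (hρ : 0 ≤ ρ) (hρs : ρ ≤ s) (hx : 0 ≤ x) :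
    1 - Real.exp (-τ * x ^ s) ≤ (1 + τ) * x ^ ρ := by
  have hxρ : 0 ≤ x ^ ρ := Real.rpow_nonneg hx ρ
  rcases le_or_gt x 1 with h | h
  · have h1 := Real.add_one_le_exp (-τ * x ^ s)
    have h2 : x ^ s ≤ x ^ ρ := Real.rpow_le_rpow_of_exponent_ge' hx h hρ hρs
    nlinarith
  · have h1 := Real.one_le_rpow h.le hρ
    have h2 := Real.exp_pos (-τ * x ^ s)
    nlinarith

lemma exists_rpow_mul_exp_neg_le {τ s : ℝ} (hτ : 0 < τ) (hs : 0 < s) (A : ℝ) {L : ℝ} (hL : 0 ≤ L) :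
    ∃ C : ℝ, 0 < C ∧ ∀ x, 0 ≤ x → (1 + A ^ 2 + x ^ 2) ^ (L / 2) * Real.exp (-τ * x ^ s) ≤ C := by
  have h1 := (tendsto_rpow_mul_exp_neg_mul_atTop_nhds_zero (L / s) τ hτ).comp (tendsto_rpow_atTop hs)
  obtain ⟨X, hX⟩ := eventually_atTop.1 (h1.eventually (gt_mem_nhds one_pos))
  set Y := max X 1 with hY
  refine ⟨(1 + A ^ 2 + Y ^ 2) ^ (L / 2) + (2 + A ^ 2) ^ (L / 2), by positivity, fun x hx => ?_⟩
  have hp1 : 0 ≤ (1 + A ^ 2 + Y ^ 2) ^ (L / 2) := by positivity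
  have hp2 : 0 ≤ (2 + A ^ 2) ^ (L / 2) := by positivity
  rcases le_or_gt x Y with h | h
  · have he : Real.exp (-τ * x ^ s) ≤ 1 := by
      rw [Real.exp_le_one_iff]
      have := Real.rpow_nonneg hx s
      nlinarith
    calc (1 + A ^ 2 + x ^ 2) ^ (L / 2) * Real.exp (-τ * x ^ s)
        ≤ (1 + A ^ 2 + Y ^ 2) ^ (L / 2) * 1 := by gcongr
      _ ≤ _ := by linarith
  · have hx1 : 1 ≤ x := (le_max_right _ _).trans h.le
    have h2 := hX x ((le_max_left _ _).trans h.le)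
    simp only [Function.comp_apply] at h2
    rw [← Real.rpow_mul hx, mul_div_cancel₀ _ hs.ne'] at h2
    have h3 : (1 + A ^ 2 + x ^ 2) ^ (L / 2) ≤ (2 + A ^ 2) ^ (L / 2) * x ^ L := by
      have h4 : x ^ L = (x ^ 2) ^ (L / 2) := by
        rw [← Real.rpow_natCast, ← Real.rpow_mul hx]
        congr 1
        push_cast
        ring
      rw [h4, ← Real.mul_rpow (by positivity) (by positivity)]
      refine Real.rpow_le_rpow (by positivity) ?_ (by positivity)
      nlinarith [sq_nonneg A, one_le_pow₀ hx1 (n := 2)]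
    calc (1 + A ^ 2 + x ^ 2) ^ (L / 2) * Real.exp (-τ * x ^ s)
        ≤ (2 + A ^ 2) ^ (L / 2) * x ^ L * Real.exp (-τ * x ^ s) := by gcongr
      _ = (2 + A ^ 2) ^ (L / 2) * (x ^ L * Real.exp (-τ * x ^ s)) := by ring
      _ ≤ (2 + A ^ 2) ^ (L / 2) * 1 := by gcongr
      _ ≤ _ := by linarith

/-- Smoothing by the kernel `exp(-τ |αξ|^s)` gains `l` derivatives at the cost `α^(-l)`. -/
lemma exists_smoothing_bound {τ s : ℝ} (hτ : 0 < τ) (hs : 0 < s) (A : ℝ) {L : ℝ} (hL : 0 ≤ L) :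
    ∃ C : ℝ, 0 < C ∧ ∀ α r l, 0 < α → 0 ≤ r → 0 ≤ l → l ≤ L → (l = 0 ∨ α ≤ A) →
      (1 + r ^ 2) ^ (l / 2) * Real.exp (-τ * (α * r) ^ s) ≤ C * α ^ (-l) := by
  obtain ⟨C, hC, hbd⟩ := exists_rpow_mul_exp_neg_le hτ hs A hL
  refine ⟨1 + C, by positivity, fun α r l hα hr hl hlL hor => ?_⟩
  have hx : 0 ≤ α * r := by positivity
  -- For l = 0 there is no weight, so α may be arbitrarily large. Otherwise α^(-l) is factored out,
  -- and α ≤ A controls the remaining α² + (αr)².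
  rcases hor with rfl | hαA
  · have he : Real.exp (-τ * (α * r) ^ s) ≤ 1 := by
      rw [Real.exp_le_one_iff]
      have := Real.rpow_nonneg hx s
      nlinarith
    simp only [zero_div, Real.rpow_zero, one_mul, neg_zero, mul_one]
    linarith
  · have h1 : (1 + r ^ 2) ^ (l / 2) = α ^ (-l) * (α ^ 2 + (α * r) ^ 2) ^ (l / 2) := by
      have h2 : (α ^ 2) ^ (l / 2) = α ^ l := by
        rw [← Real.rpow_natCast, ← Real.rpow_mul hα.le]
        congr 1
        push_cast
        ring
      rw [mul_pow, ← mul_one_add, Real.mul_rpow (by positivity) (by positivity), h2, ← mul_assoc,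
        ← Real.rpow_add hα, neg_add_cancel, Real.rpow_zero, one_mul]
    have h3 : (α ^ 2 + (α * r) ^ 2) ^ (l / 2) ≤ (1 + A ^ 2 + (α * r) ^ 2) ^ (L / 2) := by
      calc _ ≤ (1 + A ^ 2 + (α * r) ^ 2) ^ (l / 2) := by
            gcongr
            nlinarith
        _ ≤ _ := by
            refine Real.rpow_le_rpow_of_exponent_le ?_ (by linarith)
            nlinarith [sq_nonneg A, sq_nonneg (α * r)]
    calc _ = α ^ (-l) * ((α ^ 2 + (α * r) ^ 2) ^ (l / 2) * Real.exp (-τ * (α * r) ^ s)) := by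
          rw [h1]; ring
      _ ≤ α ^ (-l) * ((1 + A ^ 2 + (α * r) ^ 2) ^ (L / 2) * Real.exp (-τ * (α * r) ^ s)) := by
          gcongr
      _ ≤ α ^ (-l) * (1 + C) := by
          gcongr
          linarith [hbd _ hx]
      _ = _ := by ring

section Decay

variable {γ t T c₁ c₂ r : ℝ}

/-- t^γ (1+r²) ≤ (1+T^γ)(1+r²t^γ): a gain of two derivatives at the price t^(-γ). -/
lemma le_div_of_mittagLeffler_bounds (hc₂ : 0 < c₂)
    (hml : ∀ x, 0 ≤ x → c₁ / (1 + x) ≤ mittagLeffler γ (-x) ∧ mittagLeffler γ (-x) ≤ c₂ / (1 + x))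
    (hγ : 0 < γ) (ht : 0 < t) (htT : t ≤ T) :
    mittagLeffler γ (-r ^ 2 * t ^ γ) ≤ c₂ * (1 + T ^ γ) / t ^ γ / (1 + r ^ 2) := by
  have hT : 0 < T := ht.trans_le htT
  have htγ : 0 < t ^ γ := Real.rpow_pos_of_pos ht γ
  have hTγ : 0 < T ^ γ := Real.rpow_pos_of_pos hT γ
  have hle : t ^ γ ≤ T ^ γ := Real.rpow_le_rpow ht.le htT hγ.le
  rw [neg_mul]
  refine (hml (r ^ 2 * t ^ γ) (by positivity)).2.trans ?_
  rw [div_div, div_le_div_iff₀ (by positivity) (by positivity), mul_assoc]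
  refine mul_le_mul_of_nonneg_left ?_ hc₂.le
  nlinarith [mul_nonneg (mul_nonneg (sq_nonneg r) htγ.le) hTγ.le]

/-- The ratio is comparable to (1+r²T^γ)/(1+r²t^γ). The first bound loses no derivatives but blows
up as t → 0; the second is uniform in t but loses two. -/
lemma div_le_of_mittagLeffler_bounds (hc₁ : 0 < c₁) (hc₂ : 0 < c₂)
    (hml : ∀ x, 0 ≤ x → c₁ / (1 + x) ≤ mittagLeffler γ (-x) ∧ mittagLeffler γ (-x) ≤ c₂ / (1 + x))
    (hγ : 0 < γ) (ht : 0 < t) (htT : t ≤ T) :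
    mittagLeffler γ (-r ^ 2 * t ^ γ) / mittagLeffler γ (-r ^ 2 * T ^ γ) ≤
        c₂ / c₁ * T ^ γ / t ^ γ ∧
      mittagLeffler γ (-r ^ 2 * t ^ γ) / mittagLeffler γ (-r ^ 2 * T ^ γ) ≤
        c₂ / c₁ * (1 + T ^ γ) * (1 + r ^ 2) := by
  have hT : 0 < T := ht.trans_le htT
  have htγ : 0 < t ^ γ := Real.rpow_pos_of_pos ht γ
  have hTγ : 0 < T ^ γ := Real.rpow_pos_of_pos hT γ
  have hle : t ^ γ ≤ T ^ γ := Real.rpow_le_rpow ht.le htT hγ.le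
  have h1 : mittagLeffler γ (-r ^ 2 * t ^ γ) / mittagLeffler γ (-r ^ 2 * T ^ γ) ≤
      c₂ / c₁ * ((1 + r ^ 2 * T ^ γ) / (1 + r ^ 2 * t ^ γ)) := by
    rw [neg_mul, neg_mul]
    calc _ ≤ (c₂ / (1 + r ^ 2 * t ^ γ)) / (c₁ / (1 + r ^ 2 * T ^ γ)) := by
          gcongr
          · exact (hml (r ^ 2 * t ^ γ) (by positivity)).2
          · exact (hml (r ^ 2 * T ^ γ) (by positivity)).1
      _ = _ := by field_simp
  constructor
  · refine h1.trans ?_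
    rw [mul_div_assoc]
    gcongr ?_ * ?_
    rw [div_le_div_iff₀ (by positivity) htγ]
    nlinarith
  · refine h1.trans ?_
    rw [mul_assoc]
    gcongr ?_ * ?_
    rw [div_le_iff₀ (by positivity)]
    calc 1 + r ^ 2 * T ^ γ ≤ (1 + T ^ γ) * (1 + r ^ 2) * 1 := by nlinarith [sq_nonneg r]
      _ ≤ _ := by
        gcongr
        nlinarith [mul_nonneg (sq_nonneg r) htγ.le]

lemma pow_rpow_le {l ρ : ℝ} (hr : 0 ≤ r) (hρ : 0 ≤ ρ) :
    (1 + r ^ 2) ^ (l / 2) * r ^ ρ ≤ (1 + r ^ 2) ^ ((l + ρ) / 2) := by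
  have h1 : r ^ ρ ≤ (1 + r ^ 2) ^ (ρ / 2) := by
    calc r ^ ρ = (r ^ 2) ^ (ρ / 2) := by
          rw [← Real.rpow_natCast, ← Real.rpow_mul hr]
          congr 1
          push_cast
          ring
      _ ≤ _ := by
          gcongr
          linarith
  rw [add_div, Real.rpow_add (by positivity)]
  gcongr

end Decay

/-! ### Error splitting and parameter choice -/

/-- The error splits into an approximation error and a noise error, each controlled by a pointwise
bound on the corresponding symbol. -/
lemma IsWeakSolution.sobolevNorm_sub_le {γ T τ s p α t l E δ P Q D : ℝ} (hγ₀ : 0 < γ) (hγ₁ : γ < 1)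
    (hT : 0 < T) (hs : 0 < s) {u : ℝ → L2 n} {g gδ : L2 n} (hα : 0 < α)
    (hE0 : 0 ≤ E) (hu : IsWeakSolution γ T u g) (hE : sobolevNorm p (u 0) ≤ ENNReal.ofReal E) (hδ : ‖g - gδ‖ ≤ δ)
    (ht : t ∈ Ioc 0 T) (hP : 0 ≤ P) (hQ : 0 ≤ Q)
    (hpos : ∀ x, 0 ≤ x → 0 < mittagLeffler γ (-x))
    (hD : ∀ r, 0 ≤ r → mittagLeffler γ (-r ^ 2 * t ^ γ) / mittagLeffler γ (-r ^ 2 * T ^ γ) *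
      Real.exp (-τ * (α * r) ^ s) ≤ D)
    (hbP : ∀ r, 0 ≤ r → (1 + r ^ 2) ^ (l / 2) * (mittagLeffler γ (-r ^ 2 * t ^ γ) *
      |1 - Real.exp (-τ * (α * r) ^ s)|) ≤ P * (1 + r ^ 2) ^ (p / 2))
    (hbQ : ∀ r, 0 ≤ r → (1 + r ^ 2) ^ (l / 2) *
      (mittagLeffler γ (-r ^ 2 * t ^ γ) / mittagLeffler γ (-r ^ 2 * T ^ γ) *
        Real.exp (-τ * (α * r) ^ s)) ≤ Q) :
    sobolevNorm l (u t - regularizedSolution γ T τ s α gδ t) ≤ ENNReal.ofReal (P * E + Q * δ) := by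
  have ht0 : 0 < t := ht.1
  set Et : EuclideanSpace ℝ (Fin n) → ℝ := fun ξ => mittagLeffler γ (-‖ξ‖ ^ 2 * t ^ γ) with hEt
  set ET : EuclideanSpace ℝ (Fin n) → ℝ := fun ξ => mittagLeffler γ (-‖ξ‖ ^ 2 * T ^ γ) with hET
  set q : EuclideanSpace ℝ (Fin n) → ℝ := fun ξ => Real.exp (-τ * (α * ‖ξ‖) ^ s) with hq
  have hEt0 ξ : 0 < Et ξ := by
    rw [hEt]
    simp only [neg_mul]
    exact hpos _ (by positivity)
  have hET0 ξ : 0 < ET ξ := by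
    rw [hET]
    simp only [neg_mul]
    exact hpos _ (by positivity)
  have hq0 ξ : 0 < q ξ := Real.exp_pos _
  have hEtc : Continuous Et := (continuous_mittagLeffler hγ₀).comp (by fun_prop)
  have hETc : Continuous ET := (continuous_mittagLeffler hγ₀).comp (by fun_prop)
  have hqc : Continuous q := by
    have : Continuous fun ξ : EuclideanSpace ℝ (Fin n) => (α * ‖ξ‖) ^ s :=
      Continuous.rpow_const (by fun_prop) fun _ => Or.inr hs.le
    fun_prop
  have hsymbol (ξ : EuclideanSpace ℝ (Fin n)) :
      √(2 * Real.pi) ^ n * (mittagLeffler γ (-‖ξ‖ ^ 2 * t ^ γ) /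
        mittagLeffler γ (-‖ξ‖ ^ 2 * T ^ γ)) * kernelHat n τ s (α • ξ) = Et ξ / ET ξ * q ξ := by
    have : √(2 * Real.pi) ^ n ≠ 0 := by positivity
    rw [kernelHat, norm_smul, Real.norm_of_nonneg hα.le]
    change _ * (Et ξ / ET ξ) * (_ * q ξ) = _
    rw [mul_comm _ (Et ξ / ET ξ), mul_assoc, mul_inv_cancel_left₀ this]
  -- `fourierMultiplier` is 0 off its domain, so this membership is what identifies the regularized
  -- solution. D serves only here and does not enter the final estimate.
  have hmem : MemLp (fun η : EuclideanSpace ℝ (Fin n) =>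
      ((Et ((2 * Real.pi) • η) / ET ((2 * Real.pi) • η) * q ((2 * Real.pi) • η) : ℝ) : ℂ) *
        (𝓕 gδ : L2 n) η) 2 volume := by
    refine MemLp.of_le_mul (c := D) (Lp.memLp (𝓕 gδ : L2 n)) ?_ ?_
    · have hc : Continuous fun ξ => ((Et ξ / ET ξ * q ξ : ℝ) : ℂ) :=
        Complex.continuous_ofReal.comp ((hEtc.div hETc fun ξ => (hET0 ξ).ne').mul hqc)
      exact (hc.comp (continuous_const_smul (2 * Real.pi))).aestronglyMeasurable.mul
        (Lp.aestronglyMeasurable _)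
    · filter_upwards with η
      have h1 := hEt0 ((2 * Real.pi) • η)
      have h2 := hET0 ((2 * Real.pi) • η)
      have h3 := hq0 ((2 * Real.pi) • η)
      rw [norm_mul, Complex.norm_real, Real.norm_of_nonneg (by positivity)]
      gcongr
      exact hD _ (norm_nonneg _)
  have hreg : (𝓕 (regularizedSolution γ T τ s α gδ t) : L2 n) = hmem.toLp _ := by
    rw [regularizedSolution]
    simp_rw [hsymbol]
    rw [fourierMultiplier, dif_pos hmem, FourierTransform.fourier_fourierInv_eq]
  have hsub (f g : L2 n) : (𝓕 (f - g) : L2 n) = 𝓕 f - 𝓕 g :=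
    (Lp.fourierTransformₗᵢ (EuclideanSpace ℝ (Fin n)) ℂ).map_sub f g
  set v₀ : L2 n := 𝓕 (u 0) with hv₀
  set d : L2 n := 𝓕 (g - gδ) with hd
  set wp : EuclideanSpace ℝ (Fin n) → ℂ :=
    fun η => (((1 + ‖(2 * Real.pi) • η‖ ^ 2) ^ (p / 2) : ℝ) : ℂ) with hwp
  have hwpc : Continuous wp := by
    refine Complex.continuous_ofReal.comp (Continuous.rpow_const (by fun_prop) fun η => Or.inl ?_)
    positivity
  have hpt : ∀ᵐ η, ‖(((1 + ‖(2 * Real.pi) • η‖ ^ 2) ^ (l / 2) : ℝ) : ℂ) *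
      (𝓕 (u t - regularizedSolution γ T τ s α gδ t) : L2 n) η‖ ≤
      (P • fun η => ‖wp η * v₀ η‖) η + (Q • fun η => ‖d η‖) η := by
    have hg := hu.fourier_ae_eq hγ₀ hγ₁ hT ⟨hT.le, le_rfl⟩
    rw [hu.final] at hg
    rw [hsub, hreg]
    rw [hsub] at hd
    filter_upwards [hu.fourier_ae_eq hγ₀ hγ₁ hT (Ioc_subset_Icc_self ht), hg, hmem.coeFn_toLp,
      Lp.coeFn_sub (𝓕 (u t)) (hmem.toLp _), Lp.coeFn_sub (𝓕 g) (𝓕 gδ)] with η h1 h2 h3 h4 h5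
    set ξ := (2 * Real.pi) • η
    -- Replacing 𝓕 g by ET · v₀ makes the regularized exact data equal to Et · q · v₀; the rest is
    -- the amplified noise.
    have e1 : (𝓕 (u t) - hmem.toLp _ : L2 n) η =
        (Et ξ * (1 - q ξ) : ℝ) * v₀ η + (Et ξ / ET ξ * q ξ : ℝ) * d η := by
      rw [h4, hd, h5, Pi.sub_apply, Pi.sub_apply, h3, h1, h2, Complex.real_smul, Complex.real_smul]
      have : (ET ξ : ℂ) ≠ 0 := by exact_mod_cast (hET0 ξ).ne'
      change (Et ξ : ℂ) * v₀ η - (Et ξ / ET ξ * q ξ : ℝ) * (𝓕 gδ : L2 n) η =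
        _ + _ * ((ET ξ : ℂ) * v₀ η - _)
      push_cast
      field_simp
      ring
    have k1 := hbP ‖ξ‖ (norm_nonneg _)
    have k2 := hbQ ‖ξ‖ (norm_nonneg _)
    have hw : 0 ≤ (1 + ‖ξ‖ ^ 2) ^ (l / 2) := by positivity
    have hw' : 0 ≤ (1 + ‖ξ‖ ^ 2) ^ (p / 2) := by positivity
    have j1 := hEt0 ξ
    have j2 := hET0 ξ
    have j3 := hq0 ξ
    simp only [Pi.smul_apply, smul_eq_mul]
    rw [e1, mul_add]
    refine (norm_add_le _ _).trans (add_le_add ?_ ?_)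
    · rw [norm_mul, norm_mul, norm_mul, hwp, Complex.norm_real, Complex.norm_real,
        Complex.norm_real, Real.norm_of_nonneg hw, Real.norm_of_nonneg hw', norm_mul,
        Real.norm_of_nonneg j1.le, Real.norm_eq_abs, ← mul_assoc, ← mul_assoc P]
      exact mul_le_mul_of_nonneg_right k1 (norm_nonneg _)
    · rw [norm_mul, norm_mul, Complex.norm_real, Complex.norm_real, Real.norm_of_nonneg hw,
        Real.norm_of_nonneg (by positivity), ← mul_assoc]
      exact mul_le_mul_of_nonneg_right k2 (norm_nonneg _)
  have hm1 : AEStronglyMeasurable (fun η => wp η * v₀ η) volume :=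
    hwpc.aestronglyMeasurable.mul (Lp.aestronglyMeasurable v₀)
  calc sobolevNorm l (u t - regularizedSolution γ T τ s α gδ t)
      ≤ eLpNorm ((P • fun η => ‖wp η * v₀ η‖) + (Q • fun η => ‖d η‖)) 2 volume :=
        eLpNorm_mono_ae_real hpt
    _ ≤ eLpNorm (P • fun η => ‖wp η * v₀ η‖) 2 volume + eLpNorm (Q • fun η => ‖d η‖) 2 volume :=
        eLpNorm_add_le (hm1.norm.const_smul P) ((Lp.aestronglyMeasurable d).norm.const_smul Q)
          (by norm_num)
    _ = ENNReal.ofReal P * sobolevNorm p (u 0) + ENNReal.ofReal Q * ENNReal.ofReal ‖g - gδ‖ := by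
        rw [eLpNorm_const_smul, eLpNorm_const_smul, eLpNorm_norm, eLpNorm_norm,
          Real.enorm_of_nonneg hP, Real.enorm_of_nonneg hQ, ← Lp.norm_fourier_eq (g - gδ), ← hd,
          Lp.norm_def, ENNReal.ofReal_toReal (Lp.eLpNorm_ne_top d)]
        rfl
    _ ≤ ENNReal.ofReal P * ENNReal.ofReal E + ENNReal.ofReal Q * ENNReal.ofReal δ := by gcongr
    _ = ENNReal.ofReal (P * E + Q * δ) := by
        have hδ0 : 0 ≤ δ := (norm_nonneg _).trans hδ
        rw [ENNReal.ofReal_add (by positivity) (by positivity), ENNReal.ofReal_mul hP,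
          ENNReal.ofReal_mul hQ]

/-- The balance of errors: with α^(p+2) = δ/E, the terms α^(κ(p+2)) E and α^((κ-1)(p+2)) δ coincide.
It is used with κ = 1 - l/(p+2) and κ = (p-l)/(p+2). -/
lemma div_rpow_mul {E δ : ℝ} (hE : 0 < E) (hδ : 0 < δ) (κ : ℝ) :
    (δ / E) ^ κ * E = E ^ (1 - κ) * δ ^ κ ∧ (δ / E) ^ (κ - 1) * δ = E ^ (1 - κ) * δ ^ κ := by
  have h1 : (δ / E) ^ κ * E = E ^ (1 - κ) * δ ^ κ := by
    rw [Real.div_rpow hδ.le hE.le, Real.rpow_sub hE, Real.rpow_one]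
    have := (Real.rpow_pos_of_pos hE κ).ne'
    field_simp
  refine ⟨h1, ?_⟩
  rw [← h1, Real.rpow_sub (by positivity), Real.rpow_one]
  have := (Real.rpow_pos_of_pos (div_pos hδ hE) κ).ne'
  field_simp

end FractionalDiffusion

theorem mainTheorem4 (n : ℕ) (γ T τ s p M : ℝ) (hγ₀ : 0 < γ) (hγ₁ : γ < 1) (hT : 0 < T)
    (hτ : 0 < τ) (hs : 0 < s) (hp : 0 < p) :
    (∃ C : ℝ, 0 < C ∧ ∀ (u : ℝ → L2 n) (g gδ : L2 n) (E δ : ℝ),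
      IsWeakSolution γ T u g → 0 < E → 0 < δ →
      sobolevNorm p (u 0) ≤ ENNReal.ofReal E → ‖g - gδ‖ ≤ δ →
      ∀ t ∈ Set.Ioc 0 T, ∀ l ∈ Set.Icc 0 (p + 2), p + 2 - l ≤ s → (l = 0 ∨ δ ≤ M * E) →
        sobolevNorm l
            (u t - regularizedSolution γ T τ s ((δ / E) ^ (1 / (p + 2))) gδ t) ≤
          ENNReal.ofReal (C / t ^ γ * E ^ (l / (p + 2)) * δ ^ (1 - l / (p + 2)))) ∧
    (∃ C' : ℝ, 0 < C' ∧ ∀ (u : ℝ → L2 n) (g gδ : L2 n) (E δ : ℝ),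
      IsWeakSolution γ T u g → 0 < E → 0 < δ →
      sobolevNorm p (u 0) ≤ ENNReal.ofReal E → ‖g - gδ‖ ≤ δ → δ ≤ M * E →
      ∀ t ∈ Set.Ioc 0 T, ∀ l ∈ Set.Icc 0 p, p - l ≤ s →
        sobolevNorm l
            (u t - regularizedSolution γ T τ s ((δ / E) ^ (1 / (p + 2))) gδ t) ≤
          ENNReal.ofReal (C' * E ^ ((2 + l) / (p + 2)) * δ ^ ((p - l) / (p + 2)))) := by
  obtain ⟨c₁, c₂, hc₁, hc₂, hml⟩ := exists_mittagLeffler_bounds hγ₀ hγ₁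
  have hp2 : 0 < p + 2 := by linarith
  -- One constant for all orders up to p+2 covers l in part 1 and l+2 in part 2. The bound on α
  -- follows from δ/E ≤ M; the absolute value is there because M carries no sign assumption.
  obtain ⟨C₄, hC₄, hsm⟩ := exists_smoothing_bound hτ hs (|M| ^ (1 / (p + 2))) hp2.le
  have hTγ : 0 < T ^ γ := Real.rpow_pos_of_pos hT γ
  have hpos : ∀ x, 0 ≤ x → 0 < mittagLeffler γ (-x) := fun x hx =>
    (by positivity : 0 < c₁ / (1 + x)).trans_le (hml x hx).1
  have hαM : ∀ {E δ : ℝ}, 0 < E → 0 < δ → δ ≤ M * E →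
      (δ / E) ^ (1 / (p + 2)) ≤ |M| ^ (1 / (p + 2)) := by
    intro E δ hE hδ h
    refine Real.rpow_le_rpow (by positivity) ?_ (by positivity)
    rw [div_le_iff₀ hE]
    exact h.trans (mul_le_mul_of_nonneg_right (le_abs_self M) hE.le)
  have hmpos : ∀ {t : ℝ}, 0 < t → ∀ r : ℝ, 0 < mittagLeffler γ (-r ^ 2 * t ^ γ) := by
    intro t ht r
    rw [neg_mul]
    exact hpos _ (by positivity)
  have hq1 : ∀ {x : ℝ}, 0 ≤ x → Real.exp (-τ * x ^ s) ≤ 1 := by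
    intro x hx
    rw [Real.exp_le_one_iff]
    have := Real.rpow_nonneg hx s
    nlinarith
  have hDbd : ∀ {t α : ℝ}, t ∈ Set.Ioc 0 T → 0 < α → ∀ r, 0 ≤ r →
      mittagLeffler γ (-r ^ 2 * t ^ γ) / mittagLeffler γ (-r ^ 2 * T ^ γ) *
        Real.exp (-τ * (α * r) ^ s) ≤ c₂ / c₁ * T ^ γ / t ^ γ * 1 := by
    intro t α ht hα r hr
    have := (hmpos ht.1 r).le
    have ht0 : 0 ≤ t := ht.1.le
    exact mul_le_mul (div_le_of_mittagLeffler_bounds hc₁ hc₂ hml hγ₀ ht.1 ht.2).1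
      (hq1 (by positivity)) (Real.exp_pos _).le (by positivity)
  constructor
  · refine ⟨c₂ * (1 + T ^ γ) * (1 + τ) + c₂ / c₁ * T ^ γ * C₄, by positivity, ?_⟩
    intro u g gδ E δ hu hE hδ hE' hδ' t ht l hl hls hor
    set α := (δ / E) ^ (1 / (p + 2)) with hα
    have hα0 : 0 < α := by positivity
    have htγ : 0 < t ^ γ := Real.rpow_pos_of_pos ht.1 γ
    refine (hu.sobolevNorm_sub_le hγ₀ hγ₁ hT hs hα0 hE.le hE' hδ' ht
      (P := c₂ * (1 + T ^ γ) / t ^ γ * (1 + τ) * α ^ (p + 2 - l))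
      (Q := c₂ / c₁ * T ^ γ / t ^ γ * (C₄ * α ^ (-l)))
      (by positivity) (by positivity) hpos (hDbd ht hα0) ?_ ?_).trans_eq ?_
    · intro r hr
      have hx : 0 ≤ α * r := by positivity
      have h1 := one_sub_exp_neg_le_rpow hτ (by linarith [hl.2] : 0 ≤ p + 2 - l) hls hx
      have h2 := le_div_of_mittagLeffler_bounds (r := r) hc₂ hml hγ₀ ht.1 ht.2
      have h3 := pow_rpow_le (l := l) hr (by linarith [hl.2] : 0 ≤ p + 2 - l)
      -- The two orders beyond p are cancelled by the decay 1/(1+r²) of the Mittag-Leffler factor.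
      have h4 : (1 + r ^ 2) ^ ((l + (p + 2 - l)) / 2) = (1 + r ^ 2) ^ (p / 2) * (1 + r ^ 2) := by
        rw [← Real.rpow_add_one (by positivity)]
        ring_nf
      rw [abs_of_nonneg (by linarith [hq1 hx])]
      rw [h4] at h3
      calc _ ≤ (1 + r ^ 2) ^ (l / 2) * (c₂ * (1 + T ^ γ) / t ^ γ / (1 + r ^ 2) *
            ((1 + τ) * (α * r) ^ (p + 2 - l))) := by
            gcongr
            linarith [hq1 hx]
        _ = c₂ * (1 + T ^ γ) / t ^ γ * (1 + τ) * α ^ (p + 2 - l) / (1 + r ^ 2) *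
            ((1 + r ^ 2) ^ (l / 2) * r ^ (p + 2 - l)) := by
            rw [Real.mul_rpow hα0.le hr]
            ring
        _ ≤ c₂ * (1 + T ^ γ) / t ^ γ * (1 + τ) * α ^ (p + 2 - l) / (1 + r ^ 2) *
            ((1 + r ^ 2) ^ (p / 2) * (1 + r ^ 2)) := by gcongr
        _ = _ := by field_simp
    · intro r hr
      have h1 := (div_le_of_mittagLeffler_bounds (r := r) hc₁ hc₂ hml hγ₀ ht.1 ht.2).1
      have h2 := hsm α r l hα0 hr hl.1 hl.2 (hor.imp_right (hαM hE hδ))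
      calc _ = mittagLeffler γ (-r ^ 2 * t ^ γ) / mittagLeffler γ (-r ^ 2 * T ^ γ) *
            ((1 + r ^ 2) ^ (l / 2) * Real.exp (-τ * (α * r) ^ s)) := by ring
        _ ≤ _ := by gcongr
    · have h1 := div_rpow_mul hE hδ (1 - l / (p + 2))
      have h2 : α ^ (p + 2 - l) = (δ / E) ^ (1 - l / (p + 2)) := by
        rw [hα, ← Real.rpow_mul (by positivity)]
        congr 1
        field_simp
      have h3 : α ^ (-l) = (δ / E) ^ (1 - l / (p + 2) - 1) := by
        rw [hα, ← Real.rpow_mul (by positivity)]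
        congr 1
        ring
      rw [← h2, ← h3, sub_sub_cancel] at h1
      congr 1
      linear_combination (c₂ * (1 + T ^ γ) / t ^ γ * (1 + τ)) * h1.1 +
        (c₂ / c₁ * T ^ γ / t ^ γ * C₄) * h1.2
  · refine ⟨c₂ * (1 + τ) + c₂ / c₁ * (1 + T ^ γ) * C₄, by positivity, ?_⟩
    intro u g gδ E δ hu hE hδ hE' hδ' hM t ht l hl hls
    set α := (δ / E) ^ (1 / (p + 2)) with hα
    have hα0 : 0 < α := by positivity
    have htγ : 0 < t ^ γ := Real.rpow_pos_of_pos ht.1 γ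
    refine (hu.sobolevNorm_sub_le hγ₀ hγ₁ hT hs hα0 hE.le hE' hδ' ht
      (P := c₂ * (1 + τ) * α ^ (p - l))
      (Q := c₂ / c₁ * (1 + T ^ γ) * (C₄ * α ^ (-(l + 2))))
      (by positivity) (by positivity) hpos (hDbd ht hα0) ?_ ?_).trans_eq ?_
    · intro r hr
      have hx : 0 ≤ α * r := by positivity
      have h1 := one_sub_exp_neg_le_rpow hτ (by linarith [hl.2] : 0 ≤ p - l) hls hx
      have h2 : mittagLeffler γ (-r ^ 2 * t ^ γ) ≤ c₂ := by
        rw [neg_mul]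
        have hz : 0 ≤ r ^ 2 * t ^ γ := by positivity
        exact (hml _ hz).2.trans (div_le_self hc₂.le (by linarith))
      have h3 := pow_rpow_le (l := l) hr (by linarith [hl.2] : 0 ≤ p - l)
      rw [add_sub_cancel] at h3
      rw [abs_of_nonneg (by linarith [hq1 hx])]
      calc _ ≤ (1 + r ^ 2) ^ (l / 2) * (c₂ * ((1 + τ) * (α * r) ^ (p - l))) := by
            gcongr
            linarith [hq1 hx]
        _ = c₂ * (1 + τ) * α ^ (p - l) * ((1 + r ^ 2) ^ (l / 2) * r ^ (p - l)) := by
            rw [Real.mul_rpow hα0.le hr]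
            ring
        _ ≤ _ := by gcongr
    · intro r hr
      have h1 := (div_le_of_mittagLeffler_bounds (r := r) hc₁ hc₂ hml hγ₀ ht.1 ht.2).2
      -- The growth 1+r² of the ratio counts as two extra derivatives. The order l+2 is positive, so
      -- here δ ≤ M E is used even when l = 0.
      have h2 := hsm α r (l + 2) hα0 hr (by linarith [hl.1]) (by linarith [hl.2])
        (Or.inr (hαM hE hδ hM))
      have h4 : (1 + r ^ 2) ^ ((l + 2) / 2) = (1 + r ^ 2) ^ (l / 2) * (1 + r ^ 2) := by
        rw [← Real.rpow_add_one (by positivity)]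
        ring_nf
      rw [h4] at h2
      calc _ = mittagLeffler γ (-r ^ 2 * t ^ γ) / mittagLeffler γ (-r ^ 2 * T ^ γ) *
            ((1 + r ^ 2) ^ (l / 2) * Real.exp (-τ * (α * r) ^ s)) := by ring
        _ ≤ c₂ / c₁ * (1 + T ^ γ) * (1 + r ^ 2) *
            ((1 + r ^ 2) ^ (l / 2) * Real.exp (-τ * (α * r) ^ s)) := by gcongr
        _ = c₂ / c₁ * (1 + T ^ γ) *
            ((1 + r ^ 2) ^ (l / 2) * (1 + r ^ 2) * Real.exp (-τ * (α * r) ^ s)) := by ring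
        _ ≤ _ := by gcongr
    · have h1 := div_rpow_mul hE hδ ((p - l) / (p + 2))
      have h2 : α ^ (p - l) = (δ / E) ^ ((p - l) / (p + 2)) := by
        rw [hα, ← Real.rpow_mul (by positivity)]
        congr 1
        ring
      have h3 : α ^ (-(l + 2)) = (δ / E) ^ ((p - l) / (p + 2) - 1) := by
        rw [hα, ← Real.rpow_mul (by positivity)]
        congr 1
        field_simp
        ring
      have h5 : 1 - (p - l) / (p + 2) = (2 + l) / (p + 2) := by
        field_simp
        ring
      rw [← h2, ← h3, h5] at h1
      congr 1
      linear_combination (c₂ * (1 + τ)) * h1.1 + (c₂ / c₁ * (1 + T ^ γ) * C₄) * h1.2
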